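/- All graphs are 1-dimensional, locally finite CW complexes such that the closure of each 1-cell is homeomorphic to $[-1,1]$ (multiple edges are allowed, loops are not); the vertices are the $0$-cells and the edges are the $1$-cells. A graph is infinite if it is not a finite CW complex. Two graphs are isomorphic if there is a homeomorphism between them that maps vertices onto vertices and edges onto edges. For a function $c\colon X\to\mathbb R$ on a topological space, a contour of $c$ is a connected component of a level set $c^{-1}(t)$, the Reeb space $R_c$ is the set of all contours of $c$ with the quotient topology, and $q_c\colon X\to R_c$ is the quotient map. If $X$ is a smooth manifold without boundary and $c$ is smooth, a contour is called critical if it contains a critical point of $c$ and regular otherwise; $R_c$ is said to be the Reeb graph of $c$ if it carries the structure of a graph whose vertex set consists exactly of the points representing critical contours. Theorem. There exists a connected infinite graph $G_1$ such that, for every integer $m>1$, the following holds. Let $e_m\colon\mathbb R^{m+1}\to\mathbb R$ be the function $$e_m(x_1,x_2,y_1,\dots,y_{m-1})=\Bigl(x_1-\frac{\sin^2 x_2}{2(x_2^2+1)}\Bigr)\Bigl(\frac1{x_2^2+1}-x_1\Bigr)-\sum_{j=1}^{m-1}y_j^2,$$ let $X_m=e_m^{-1}(0)$, and let $c_m\colon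 X_m\to\mathbb R$ be the restriction of the projection to the first coordinate $x_1$. Then: 1. $e_m$ is real analytic, and $X_m$ is a non-compact, connected, smooth $m$-dimensional submanifold of $\mathbb R^{m+1}$ (so that $c_m$ is a smooth function); 2. the Reeb space $R_{c_m}$ is the Reeb graph of $c_m$, and this graph is isomorphic to $G_1$; 3. the quotient map $q_{c_m}\colon X_m\to R_{c_m}$ is proper (preimages of compact sets are compact), and every regular contour of $c_m$ is diffeomorphic to the sphere $S^{m-1}$. -/

import Mathlib

open Set Topology Manifold
open scoped ContDiff

noncomputable section

namespace Reeb

/-! ### Reeb spaces -/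

section ReebSpace

variable {X Y : Type*} [TopologicalSpace X]

/-- The contour of `c` through `x`: the connected component containing `x` of the level set
`c ⁻¹ (c x)`. Every contour of `c` is of this form. -/
def contour (c : X → Y) (x : X) : Set X :=
  connectedComponentIn (c ⁻¹' {c x}) x

theorem mem_contour_self (c : X → Y) (x : X) : x ∈ contour c x :=
  mem_connectedComponentIn rfl

theorem contour_eq_of_mem {c : X → Y} {x y : X} (h : y ∈ contour c x) :
    contour c y = contour c x := by
  have hc : c y = c x := connectedComponentIn_subset (c ⁻¹' {c x}) x h
  unfold contour at h ⊢
  rw [hc]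
  exact (connectedComponentIn_eq h).symm

/-- Two points are equivalent when they lie in the same connected component of a level set. -/
def contourSetoid (c : X → Y) : Setoid X where
  r x y := y ∈ contour c x
  iseqv :=
    { refl := mem_contour_self c
      symm := fun {x y} h => by rw [contour_eq_of_mem h]; exact mem_contour_self c x
      trans := fun {x y z} h h' => by rwa [contour_eq_of_mem h] at h' }

/-- The Reeb space of `c`, the space of all contours of `c` with the quotient topology. -/
abbrev ReebSpace (c : X → Y) : Type _ := Quotient (contourSetoid c)

/-- The quotient map onto the Reeb space. -/
def quotientMap (c : X → Y) : X → ReebSpace c := Quotient.mk (contourSetoid c)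

end ReebSpace

/-! ### Graphs as one-dimensional CW complexes -/

section Graph

/-- The set of all (open) `n`-cells of a CW complex. -/
def openCells (G : Type*) [TopologicalSpace G] [CWComplex (univ : Set G)] (n : ℕ) :
    Set (Set G) :=
  range fun i : RelCWComplex.cell (univ : Set G) n => RelCWComplex.openCell n i

/-- The set of vertices (the points which are `0`-cells). -/
def vertexSet (G : Type*) [TopologicalSpace G] [CWComplex (univ : Set G)] : Set G :=
  ⋃₀ openCells G 0

/-- A graph: a one-dimensional, locally finite (Hausdorff) CW complex such that the closure of
each `1`-cell is homeomorphic to `[-1, 1]`. Multiple edges are allowed, loops are not. -/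
structure IsGraph (G : Type*) [TopologicalSpace G] [CWComplex (univ : Set G)] : Prop where
  t2 : T2Space G
  nonempty_edge : (openCells G 1).Nonempty
  isEmpty_cell : ∀ n, 1 < n → IsEmpty (RelCWComplex.cell (univ : Set G) n)
  locallyFinite : LocallyFinite
    fun p : Σ n, RelCWComplex.cell (univ : Set G) n => RelCWComplex.closedCell p.1 p.2
  closure_edge : ∀ e ∈ openCells G 1, Nonempty (closure e ≃ₜ Icc (-1 : ℝ) 1)

/-- An infinite graph: a graph which is not a finite CW complex. -/
structure IsInfiniteGraph (G : Type*) [TopologicalSpace G] [CWComplex (univ : Set G)] : Prop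
    extends IsGraph G where
  not_finite : ¬ RelCWComplex.Finite (univ : Set G)

/-- Two graphs are isomorphic when there is a homeomorphism between them which maps the vertices
onto the vertices and the edges onto the edges. -/
def GraphIsomorphic (G H : Type*) [TopologicalSpace G] [CWComplex (univ : Set G)]
    [TopologicalSpace H] [CWComplex (univ : Set H)] : Prop :=
  ∃ φ : G ≃ₜ H, ∀ n, (fun e : Set G => φ '' e) '' openCells G n = openCells H n

end Graph

/-! ### Smooth functions on manifolds: critical points, Reeb graphs, spheres -/

section Smooth

variable {m : ℕ} {M : Type*} [TopologicalSpace M] [ChartedSpace (EuclideanSpace ℝ (Fin m)) M]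

/-- The set of critical points of a (smooth) real-valued function on an `m`-manifold. -/
def criticalPoints (c : M → ℝ) : Set M :=
  {x | mfderiv (𝓡 m) 𝓘(ℝ, ℝ) c x = 0}

/-- A set of points (such as a contour) is regular when it contains no critical point. -/
def IsRegularSet (c : M → ℝ) (C : Set M) : Prop :=
  ∀ y ∈ C, y ∉ criticalPoints (m := m) c

/-- A CW structure on the Reeb space of `c` is the Reeb graph of `c` when it is a graph and its
vertices are exactly the points which represent contours containing critical points. -/
structure IsReebGraph (c : M → ℝ) [CWComplex (univ : Set (ReebSpace c))] : Prop where
  isGraph : IsGraph (ReebSpace c)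
  vertexSet_eq : vertexSet (ReebSpace c) = quotientMap c '' criticalPoints (m := m) c

/-- A subset `C` of a manifold is diffeomorphic to the unit sphere `S^k ⊂ ℝ^(k+1)`, that is, it
is the image of a smooth embedding of `S^k`. -/
def IsDiffeomorphicToSphere (k : ℕ) (C : Set M) : Prop :=
  ∃ f : Metric.sphere (0 : EuclideanSpace ℝ (Fin (k + 1))) 1 → M,
    IsSmoothEmbedding (𝓡 k) (𝓡 m) ∞ f ∧ range f = C

end Smooth

/-! ### The explicit functions and hypersurfaces -/

/-- The function `(x₁ - sin² x₂ / (2 (x₂² + 1))) (1 / (x₂² + 1) - x₁) - ∑ yⱼ²` on `ℝ^(m+1)`, with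
coordinates `(x₁, x₂, y₁, …, y_{m-1})`. -/
def definingFun (m : ℕ) (x : EuclideanSpace ℝ (Fin (m + 1))) : ℝ :=
  (x 0 - Real.sin (x 1) ^ 2 / (2 * (x 1 ^ 2 + 1))) * (1 / (x 1 ^ 2 + 1) - x 0)
    - ∑ j : Fin (m + 1) with 2 ≤ j.val, x j ^ 2

/-- The zero set of `definingFun m`. -/
def zeroSet (m : ℕ) : Set (EuclideanSpace ℝ (Fin (m + 1))) := {x | definingFun m x = 0}

/-- The restriction to `zeroSet m` of the projection to the first coordinate. -/
def firstCoord (m : ℕ) : zeroSet m → ℝ := fun x => x.1 0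

end Reeb

end

/-! Write `slice s t = (s - lower t) * (upper t - s)`. A point of the hypersurface is a point `(s,
t)` of the plane with a vector `y` such that `∑ y_j ^ 2 = slice s t`. It therefore lies over
`region`, where `lower t ≤ s ≤ upper t`, with a sphere of radius `√(slice s t)` over each point,
collapsed to a point on the boundary curves. Consequently contours correspond to components of the
horizontal slices of `region`, independently of `m`.

The function `lower` vanishes at the multiples of `π` and has exactly one hump between consecutive
ones (`critical_eq_aux`); moving away from the origin the humps get strictly lower
(`lower_peak_succ_lt`). As `upper` decreases in `|t|`, two points of the slice at level `s` are in
the same component iff `lower ≤ s` between them. The component belonging to `l * π` is thus born at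
level `0` and, for `l ≠ 0`, merges at the height of the hump on its inner side with the component of
the next multiple of `π` towards the origin. The result is an infinite tree: a trunk `l = 0` over
`[0, 1]`, with stem `±(n + 1)` growing out of stem `±n`.

To get the topology and not only the combinatorics, `label s t` integrates from `0` to `t` the
positive part of `sin x ^ 2 - 2 * s * (x ^ 2 + 1)`, which vanishes exactly where `lower x ≤ s`. It
is jointly continuous, it separates the components of a slice (`label_eq_iff`), and it grows at
least linearly in `|t|` on `region` (`le_label`). Hence `(s, t) ↦ (s, label s t)` induces a proper
map `toTree` from the hypersurface onto a planar set `tree`, whose fibres are the contours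
(`mem_contour_iff`). Proper maps are closed, so the Reeb space is homeomorphic to `tree`
(`reebHomeomorph`). The same growth makes the edges of `tree` locally finite. The space `tree`
serves as the common graph for all `m`.

Critical points are the points with `y = 0` over critical points of `lower`, or over the top `(1,
0)`; they give exactly the free ends, the merging points and the top. A regular contour lies over an
interval `[a, b]` on which `slice s` is positive inside with simple zeros at the ends. Thus `slice s
t = (t - a) * (b - t) * k t` with `k > 0` smooth, and rescaling `y` by `√k` turns the contour into a
round sphere (`isDiffeomorphicToSphere_contour`). -/

noncomputable section

namespace Reeb

/-! ### Inverse function theorem with a smooth inverse on an open set -/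

section InverseFunction

variable {E F : Type*} [NormedAddCommGroup E] [NormedSpace ℝ E] [NormedAddCommGroup F]
  [NormedSpace ℝ F] [CompleteSpace E]

/-- Inverse function theorem: a smooth map with invertible derivative at a point is a
diffeomorphism between suitable open sets. -/
theorem exists_openPartialHomeomorph_contDiffOn {f : E → F} {U : Set E} {a : E} (hU : IsOpen U)
    (ha : a ∈ U) (hf : ContDiffOn ℝ ∞ f U) (f' : E ≃L[ℝ] F)
    (hf' : HasFDerivAt f (f' : E →L[ℝ] F) a) :
    ∃ e : OpenPartialHomeomorph E F, (e : E → F) = f ∧ a ∈ e.source ∧ e.source ⊆ U ∧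
      ContDiffOn ℝ ∞ e.symm e.target := by
  have hfa : ContDiffAt ℝ ∞ f a := hf.contDiffAt (hU.mem_nhds ha)
  have hn : (∞ : WithTop ℕ∞) ≠ 0 := by simp
  let e₀ := hfa.toOpenPartialHomeomorph f hf' hn
  -- Invertibility of the derivative is an open condition; imposing it on the whole source makes the
  -- inverse smooth on the whole target, not only at the image of `a`.
  let V : Set E := U ∩ fderiv ℝ f ⁻¹' range ((↑) : (E ≃L[ℝ] F) → E →L[ℝ] F)
  have hV : IsOpen V :=
    (hf.continuousOn_fderiv_of_isOpen hU (by simp)).isOpen_inter_preimage hU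
      ContinuousLinearEquiv.isOpen
  refine ⟨e₀.restrOpen V hV, rfl, ⟨?_, ha, f', hf'.fderiv.symm⟩, ?_, ?_⟩
  · exact hfa.mem_toOpenPartialHomeomorph_source hf' hn
  · exact fun x hx => hx.2.1
  · intro y hy
    have hy' : (e₀.restrOpen V hV).symm y ∈ (e₀.restrOpen V hV).source :=
      (e₀.restrOpen V hV).map_target hy
    obtain ⟨hyU, A, hA⟩ := hy'.2
    refine ((e₀.restrOpen V hV).contDiffAt_symm (f₀' := A) hy ?_
      (hf.contDiffAt (hU.mem_nhds hyU))).contDiffWithinAt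
    rw [hA]
    exact ((hf.contDiffAt (hU.mem_nhds hyU)).differentiableAt hn).hasFDerivAt

end InverseFunction

/-! ### Regular level sets as embedded manifolds -/

section Hypersurface

variable {E K : Type*} [NormedAddCommGroup E] [NormedSpace ℝ E]
  [NormedAddCommGroup K] [NormedSpace ℝ K]

-- The kernel of `l` has the dimension of `K`, and a vector `v₀` with `l v₀ = 1` spans a complement;
-- `(k, r) ↦ k + r • v₀` is inverted.
variable [FiniteDimensional ℝ E] [FiniteDimensional ℝ K] in
theorem exists_linearEquiv_snd_eq (hdim : Module.finrank ℝ K + 1 = Module.finrank ℝ E)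
    (l : E →L[ℝ] ℝ) (hl : l ≠ 0) : ∃ A : E ≃L[ℝ] K × ℝ, ∀ v, (A v).2 = l v := by
  have hker : Module.finrank ℝ l.ker = Module.finrank ℝ K := by
    have h := l.toLinearMap.finrank_range_add_finrank_ker
    have hr : l.toLinearMap.range = ⊤ := by
      apply LinearMap.range_eq_top.2
      apply LinearMap.surjective
      intro h
      exact hl (ContinuousLinearMap.coe_injective h)
    rw [hr, finrank_top, Module.finrank_self] at h
    change Module.finrank ℝ (l.toLinearMap.ker) = _
    omega
  obtain ⟨v₀, hv₀⟩ : ∃ v, l v = 1 := by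
    have : ∃ v, l v ≠ 0 := by
      by_contra! h
      exact hl (ContinuousLinearMap.ext h)
    obtain ⟨v, hv⟩ := this
    exact ⟨(l v)⁻¹ • v, by simp [hv]⟩
  let B : l.ker ≃L[ℝ] K := ContinuousLinearEquiv.ofFinrankEq hker
  let T : K × ℝ →ₗ[ℝ] E :=
    (l.ker.subtype ∘ₗ (B.symm : K →ₗ[ℝ] l.ker)).coprod (LinearMap.toSpanSingleton ℝ E v₀)
  have hT : ∀ p, T p = (B.symm p.1 : E) + p.2 • v₀ := fun p => by simp [T]
  have hlT : ∀ p, l (T p) = p.2 := fun p => by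
    have : l (B.symm p.1 : E) = 0 := (B.symm p.1).2
    rw [hT, map_add, this, map_smul, hv₀]; simp
  have hinj : Function.Injective T := by
    rw [← LinearMap.ker_eq_bot, LinearMap.ker_eq_bot']
    intro p hp
    have h2 : p.2 = 0 := by rw [← hlT, hp, map_zero]
    rw [hT, h2, zero_smul, add_zero] at hp
    have h1 : p.1 = 0 := by
      have : B.symm p.1 = 0 := Subtype.ext hp
      simpa using this
    exact Prod.ext h1 h2
  let T' : (K × ℝ) ≃ₗ[ℝ] E := LinearEquiv.ofInjectiveOfFinrankEq T hinj (by simpa using hdim)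
  refine ⟨T'.symm.toContinuousLinearEquiv, fun v => ?_⟩
  rw [← hlT]
  congr 1
  exact T'.apply_symm_apply v

/-- Local straightening of a regular level set. -/
structure Straightening (K : Type*) [NormedAddCommGroup K] [NormedSpace ℝ K] (F : E → ℝ)
    (x : E) where
  lin : E ≃L[ℝ] K × ℝ
  equiv : OpenPartialHomeomorph E (K × ℝ)
  mem_source : x ∈ equiv.source
  coe_equiv : ∀ y, equiv y = ((lin y).1, F y)
  contDiffOn_symm : ContDiffOn ℝ ∞ equiv.symm equiv.target

-- Keep the `K`-part of linear coordinates adapted to `fderiv ℝ F x` and replace the last coordinate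
-- by `F`: the derivative at `x` is that linear isomorphism itself.
variable [FiniteDimensional ℝ E] [FiniteDimensional ℝ K] in
theorem nonempty_straightening (hdim : Module.finrank ℝ K + 1 = Module.finrank ℝ E) {F : E → ℝ}
    (hF : ContDiff ℝ ∞ F) {x : E} (hx : fderiv ℝ F x ≠ 0) : Nonempty (Straightening K F x) := by
  obtain ⟨A, hA⟩ := exists_linearEquiv_snd_eq hdim (fderiv ℝ F x) hx
  let P : E →L[ℝ] K := (ContinuousLinearMap.fst ℝ K ℝ).comp (A : E →L[ℝ] K × ℝ)
  have hd : HasFDerivAt (fun y => (P y, F y)) (A : E →L[ℝ] K × ℝ) x := by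
    have h := P.hasFDerivAt.prodMk ((hF.differentiable (by simp)) x).hasFDerivAt
    convert h using 1
    ext v
    · simp [P]
    · simp [hA]
  have : CompleteSpace E := FiniteDimensional.complete ℝ E
  obtain ⟨e, he, hxe, -, hs⟩ := exists_openPartialHomeomorph_contDiffOn isOpen_univ (mem_univ x)
    ((P.contDiff.prodMk hF).contDiffOn) A hd
  exact ⟨⟨A, e, hxe, fun y => by rw [he]; rfl, hs⟩⟩

namespace Straightening

variable {F : E → ℝ} {x : E}

theorem mem_zero (Φ : Straightening K F x) {v : K} (hv : (v, (0 : ℝ)) ∈ Φ.equiv.target) :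
    F (Φ.equiv.symm (v, 0)) = 0 := by
  have := Φ.equiv.right_inv hv
  rw [Φ.coe_equiv] at this
  exact congrArg Prod.snd this

open Classical in
/-- The chart of the zero set induced by a straightening. -/
def chart (Φ : Straightening K F x) (hx : F x = 0) : OpenPartialHomeomorph {y | F y = 0} K where
  toFun y := (Φ.lin y).1
  -- Outside the target the inverse takes the default value `x`.
  invFun v := if hv : (v, (0 : ℝ)) ∈ Φ.equiv.target then ⟨Φ.equiv.symm (v, 0), Φ.mem_zero hv⟩
    else ⟨x, hx⟩
  source := Subtype.val ⁻¹' Φ.equiv.source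
  target := (fun v => (v, (0 : ℝ))) ⁻¹' Φ.equiv.target
  map_source' y hy := by
    have h := Φ.equiv.map_source hy
    rw [Φ.coe_equiv, y.2] at h
    exact h
  map_target' v hv := by
    rw [mem_preimage] at hv
    rw [dif_pos hv]
    exact Φ.equiv.map_target hv
  left_inv' y hy := by
    have h := Φ.equiv.map_source hy
    have h2 := Φ.equiv.left_inv hy
    rw [Φ.coe_equiv, y.2] at h h2
    rw [dif_pos h]
    exact Subtype.ext h2
  right_inv' v hv := by
    rw [mem_preimage] at hv
    have h := Φ.equiv.right_inv hv
    rw [Φ.coe_equiv] at h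
    rw [dif_pos hv]
    exact congrArg Prod.fst h
  open_source := Φ.equiv.open_source.preimage continuous_subtype_val
  open_target := Φ.equiv.open_target.preimage (by fun_prop)
  continuousOn_toFun := by fun_prop
  continuousOn_invFun := by
    rw [Topology.IsEmbedding.subtypeVal.isInducing.continuousOn_iff]
    refine (Φ.equiv.continuousOn_symm.comp (f := fun v : K => (v, (0 : ℝ))) (by fun_prop)
      (fun v hv => hv)).congr fun v hv => ?_
    have hv' : (v, (0 : ℝ)) ∈ Φ.equiv.target := hv
    simp only [Function.comp_apply]
    rw [dif_pos hv']

theorem chart_symm_apply (Φ : Straightening K F x) (hx : F x = 0) {v : K}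
    (hv : v ∈ (Φ.chart hx).target) :
    ((Φ.chart hx).symm v : E) = Φ.equiv.symm (v, 0) := by
  exact congrArg Subtype.val (dif_pos (show (v, (0 : ℝ)) ∈ Φ.equiv.target from hv))

theorem contDiffOn_chart_symm (Φ : Straightening K F x) (hx : F x = 0) :
    ContDiffOn ℝ ∞ (fun v => ((Φ.chart hx).symm v : E)) (Φ.chart hx).target :=
  (Φ.contDiffOn_symm.comp (f := fun v : K => (v, (0 : ℝ))) (by fun_prop)
    (fun v hv => hv)).congr fun v hv => Φ.chart_symm_apply hx hv

end Straightening

/-- The data making the zero set of `F` a regular level set. -/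
structure IsRegularZero (K : Type*) [NormedAddCommGroup K] [NormedSpace ℝ K] (F : E → ℝ) :
    Prop where
  finrank_add_one : Module.finrank ℝ K + 1 = Module.finrank ℝ E
  contDiff : ContDiff ℝ ∞ F
  fderiv_ne_zero : ∀ x, F x = 0 → fderiv ℝ F x ≠ 0

namespace IsRegularZero

variable [FiniteDimensional ℝ E] [FiniteDimensional ℝ K] {F : E → ℝ} (hF : IsRegularZero K F)

/-- A choice of straightening at each point of the zero set. -/
def straightening (x : {y | F y = 0}) : Straightening K F (x : E) :=
  (nonempty_straightening hF.finrank_add_one hF.contDiff (hF.fderiv_ne_zero x x.2)).some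

/-- A regular zero set is a manifold. -/
@[reducible]
def chartedSpace : ChartedSpace K {y | F y = 0} where
  atlas := range fun x : {y | F y = 0} => (hF.straightening x).chart x.2
  chartAt x := (hF.straightening x).chart x.2
  mem_chart_source x := (hF.straightening x).mem_source
  chart_mem_atlas x := mem_range_self x

/-- Every chart is the restriction of a linear map of the ambient space, so a transition map is that
linear map after a smooth inverse chart. -/
theorem isManifold : @IsManifold ℝ _ K _ _ K _ 𝓘(ℝ, K) ∞ {y | F y = 0} _ hF.chartedSpace := by
  let _ := hF.chartedSpace
  apply isManifold_of_contDiffOn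
  rintro _ _ ⟨x, rfl⟩ ⟨x', rfl⟩
  have h := (hF.straightening x).contDiffOn_chart_symm x.2
  have h2 : ContDiff ℝ ∞ (fun y : E => ((hF.straightening x').lin y).1) := by fun_prop
  refine (h2.comp_contDiffOn (h.mono ?_)).congr ?_
  · intro v hv
    exact hv.1.1
  · intro v hv
    rfl

/-- The straightening, followed by `Φ.lin.symm` to land in `E` again, is an ambient chart in which
the inclusion reads `v ↦ Φ.lin.symm (v, 0)`. -/
theorem isImmersionAtOfComplement_val (x : {y | F y = 0}) :
    let _ := hF.chartedSpace
    IsImmersionAtOfComplement ℝ 𝓘(ℝ, K) 𝓘(ℝ, E) ∞ (Subtype.val : {y | F y = 0} → E) x := by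
  let _ := hF.chartedSpace
  have := hF.isManifold
  let Φ := hF.straightening x
  refine IsImmersionAtOfComplement.mk_of_continuousAt continuousAt_subtype_val Φ.lin.symm
    (Φ.chart x.2) (Φ.equiv ≫ₕ Φ.lin.symm.toHomeomorph.toOpenPartialHomeomorph)
    Φ.mem_source ?_ ?_ ?_ ?_
  · exact ⟨Φ.mem_source, mem_univ _⟩
  · exact IsManifold.chart_mem_maximalAtlas x
  · apply StructureGroupoid.mem_maximalAtlas_of_mem_groupoid
    rw [contDiffGroupoid, mem_groupoid_of_pregroupoid]
    constructor
    · have : ContDiff ℝ ∞ fun y => Φ.lin.symm ((Φ.lin y).1, F y) := by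
        have := hF.contDiff
        fun_prop
      refine this.contDiffOn.congr fun y hy => ?_
      change Φ.lin.symm (Φ.equiv y) = _
      rw [Φ.coe_equiv]
    · refine (Φ.contDiffOn_symm.comp (f := Φ.lin) (t := Φ.equiv.target)
        Φ.lin.contDiff.contDiffOn ?_)
      intro y hy
      exact hy.1.2
  · intro v hv
    have hv' : v ∈ (Φ.chart x.2).target := by simpa using hv
    have h := Φ.equiv.right_inv hv'
    change Φ.lin.symm (Φ.equiv ((Φ.chart x.2).symm v : E)) = Φ.lin.symm (v, 0)
    rw [Φ.chart_symm_apply x.2 hv', h]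

theorem isSmoothEmbedding_val :
    let _ := hF.chartedSpace
    IsSmoothEmbedding 𝓘(ℝ, K) 𝓘(ℝ, E) ∞ (Subtype.val : {y | F y = 0} → E) := by
  let _ := hF.chartedSpace
  exact ⟨IsImmersionOfComplement.isImmersion (F := ℝ) fun x =>
    hF.isImmersionAtOfComplement_val x, IsEmbedding.subtypeVal⟩

/-- The differential of the restriction of `G` to the zero set of `F` vanishes iff the
differential of `G` vanishes on the kernel of that of `F`. -/
theorem mfderiv_comp_val_eq_zero_iff {G : E → ℝ} (hG : ContDiff ℝ ∞ G) (x : {y | F y = 0}) :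
    let _ := hF.chartedSpace
    mfderiv 𝓘(ℝ, K) 𝓘(ℝ, ℝ) (fun y : {y | F y = 0} => G y) x = 0 ↔
      ∀ v, fderiv ℝ F x v = 0 → fderiv ℝ G x v = 0 := by
  let _ := hF.chartedSpace
  have hval := (hF.isSmoothEmbedding_val).contMDiff
  have hd : MDifferentiableAt 𝓘(ℝ, K) 𝓘(ℝ, ℝ) (fun y : {y | F y = 0} => G y) x :=
    ((hG.contMDiff.comp hval) x).mdifferentiableAt (by simp)
  let Φ := hF.straightening x
  have hxt : (Φ.equiv x) ∈ Φ.equiv.target := Φ.equiv.map_source Φ.mem_source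
  have hx0 : Φ.equiv x = ((Φ.lin x).1, 0) := by
    rw [Φ.coe_equiv, x.2]
  have hsymm : DifferentiableAt ℝ Φ.equiv.symm (Φ.equiv x) :=
    (Φ.contDiffOn_symm.contDiffAt (Φ.equiv.open_target.mem_nhds hxt)).differentiableAt (by simp)
  set D := fderiv ℝ Φ.equiv.symm (Φ.equiv x) with hD
  have hΦ : HasFDerivAt Φ.equiv
      (((ContinuousLinearMap.fst ℝ K ℝ).comp (Φ.lin : E →L[ℝ] K × ℝ)).prod (fderiv ℝ F x)) x := by
    have h := (((ContinuousLinearMap.fst ℝ K ℝ).comp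
      (Φ.lin : E →L[ℝ] K × ℝ)).hasFDerivAt (x := (x : E))).prodMk
      ((hF.contDiff.differentiable (by simp)) x).hasFDerivAt
    refine h.congr_of_eventuallyEq (Filter.Eventually.of_forall fun y => ?_)
    rw [Φ.coe_equiv]; rfl
  -- `hDΦ` and `hΦD` differentiate the two composites of the straightening with its inverse.
  -- Together they show that `w ↦ D (w, 0)` parametrizes the kernel of `fderiv ℝ F x`.
  have hDΦ : ∀ v, D ((Φ.lin v).1, fderiv ℝ F x v) = v := by
    have h1 : HasFDerivAt (Φ.equiv.symm ∘ Φ.equiv) (D.comp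
      (((ContinuousLinearMap.fst ℝ K ℝ).comp (Φ.lin : E →L[ℝ] K × ℝ)).prod (fderiv ℝ F x)))
      (x : E) := hsymm.hasFDerivAt.comp (x : E) hΦ
    have h2 : HasFDerivAt (Φ.equiv.symm ∘ Φ.equiv) (ContinuousLinearMap.id ℝ E) (x : E) := by
      refine (hasFDerivAt_id (x : E)).congr_of_eventuallyEq ?_
      filter_upwards [Φ.equiv.open_source.mem_nhds Φ.mem_source] with y hy
      exact Φ.equiv.left_inv hy
    intro v
    exact congrArg (fun L : E →L[ℝ] E => L v) (h1.unique h2)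
  have hΦD : ∀ w, fderiv ℝ F x (D w) = w.2 := by
    have hΦ' : HasFDerivAt Φ.equiv
      (((ContinuousLinearMap.fst ℝ K ℝ).comp (Φ.lin : E →L[ℝ] K × ℝ)).prod (fderiv ℝ F x))
      (Φ.equiv.symm (Φ.equiv x)) := by
      rw [Φ.equiv.left_inv Φ.mem_source]; exact hΦ
    have h1 := hΦ'.comp (Φ.equiv x) hsymm.hasFDerivAt
    have h2 : HasFDerivAt (Φ.equiv ∘ Φ.equiv.symm) (ContinuousLinearMap.id ℝ (K × ℝ))
        (Φ.equiv x) := by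
      refine (hasFDerivAt_id _).congr_of_eventuallyEq ?_
      filter_upwards [Φ.equiv.open_target.mem_nhds hxt] with y hy
      exact Φ.equiv.right_inv hy
    intro w
    have := congrArg (fun L : K × ℝ →L[ℝ] K × ℝ => (L w).2) (h1.unique h2)
    exact this
  -- In the chart the restricted function is `v ↦ G (Φ.equiv.symm (v, 0))`, so its differential is
  -- that of `G` along the kernel.
  have hmf : ∀ v, mfderiv 𝓘(ℝ, K) 𝓘(ℝ, ℝ) (fun y : {y | F y = 0} => G y) x v =
      fderiv ℝ G x (D (v, 0)) := by
    intro v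
    rw [hd.mfderiv]
    have hw : HasFDerivAt (fun v : K => G (Φ.equiv.symm (v, 0)))
        (((fderiv ℝ G x).comp D).comp (ContinuousLinearMap.inl ℝ K ℝ)) (Φ.lin x).1 := by
      have h1 : HasFDerivAt (fun v : K => (v, (0 : ℝ))) (ContinuousLinearMap.inl ℝ K ℝ)
        (Φ.lin x).1 := (ContinuousLinearMap.inl ℝ K ℝ).hasFDerivAt
      have h2 : HasFDerivAt Φ.equiv.symm D ((Φ.lin x).1, 0) := by
        rw [← hx0]; exact hsymm.hasFDerivAt
      have h3 : HasFDerivAt G (fderiv ℝ G x) (Φ.equiv.symm ((Φ.lin x).1, 0)) := by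
        rw [← hx0, Φ.equiv.left_inv Φ.mem_source]
        exact (hG.differentiable (by simp) _).hasFDerivAt
      exact (h3.comp _ h2).comp (Φ.lin x).1 h1
    have hev : HasFDerivAt (writtenInExtChartAt 𝓘(ℝ, K) 𝓘(ℝ, ℝ) x
        (fun y : {y | F y = 0} => G y))
        (((fderiv ℝ G x).comp D).comp (ContinuousLinearMap.inl ℝ K ℝ))
        (extChartAt 𝓘(ℝ, K) x x) := by
      refine HasFDerivAt.congr_of_eventuallyEq (x := (Φ.lin x).1) hw ?_
      filter_upwards [(Φ.chart x.2).open_target.mem_nhds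
        ((Φ.chart x.2).map_source Φ.mem_source)] with v hv
      change G ((Φ.chart x.2).symm v : E) = _
      rw [Φ.chart_symm_apply x.2 hv]
    have := hev.fderiv
    simp only [modelWithCornersSelf_coe, range_id, fderivWithin_univ]
    rw [this]
    rfl
  constructor
  · intro h v hv
    have := hmf (Φ.lin v).1
    rw [h] at this
    rw [← hDΦ v, hv]
    exact this.symm
  · intro h
    ext v
    rw [hmf]
    exact h _ (hΦD _)

end IsRegularZero

end Hypersurface

/-! ### Maps with injective differential are immersions -/

section Immersion

variable {E K W M N : Type*} [NormedAddCommGroup E] [NormedSpace ℝ E] [FiniteDimensional ℝ E]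
  [NormedAddCommGroup K] [NormedSpace ℝ K] [FiniteDimensional ℝ K]
  [NormedAddCommGroup W] [NormedSpace ℝ W] [FiniteDimensional ℝ W]
  [TopologicalSpace M] [ChartedSpace K M] [IsManifold 𝓘(ℝ, K) ∞ M]
  [TopologicalSpace N] [ChartedSpace E N] [IsManifold 𝓘(ℝ, E) ∞ N]

variable (W) in
theorem exists_linearEquiv_inl_eq
    (hdim : Module.finrank ℝ K + Module.finrank ℝ W = Module.finrank ℝ E)
    (B : K →L[ℝ] E) (hB : Function.Injective B) :
    ∃ (T : (K × W) ≃L[ℝ] E) (C : W →L[ℝ] E), ∀ p, T p = B p.1 + C p.2 := by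
  obtain ⟨V, hV⟩ := Submodule.exists_isCompl (LinearMap.range B.toLinearMap)
  have hr : Module.finrank ℝ (LinearMap.range B.toLinearMap) = Module.finrank ℝ K :=
    LinearMap.finrank_range_of_inj hB
  have hVd : Module.finrank ℝ W = Module.finrank ℝ V := by
    have := Submodule.finrank_add_eq_of_isCompl hV
    omega
  let e : W ≃ₗ[ℝ] V := LinearEquiv.ofFinrankEq _ _ hVd
  let T : (K × W) ≃ₗ[ℝ] E :=
    ((LinearEquiv.ofInjective B.toLinearMap hB).prodCongr e).trans
      (Submodule.prodEquivOfIsCompl _ _ hV)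
  refine ⟨T.toContinuousLinearEquiv,
    LinearMap.toContinuousLinearMap (V.subtype ∘ₗ (e : W →ₗ[ℝ] V)), fun p => ?_⟩
  change T p = _
  simp [T]

variable (W) in
/-- A smooth map with injective differential is an immersion. -/
theorem isImmersionAtOfComplement_of_injective_mfderiv
    (hdim : Module.finrank ℝ K + Module.finrank ℝ W = Module.finrank ℝ E)
    {f : M → N} (hf : ContMDiff 𝓘(ℝ, K) 𝓘(ℝ, E) ∞ f) {x : M}
    (hx : Function.Injective (mfderiv 𝓘(ℝ, K) 𝓘(ℝ, E) f x)) :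
    IsImmersionAtOfComplement W 𝓘(ℝ, K) 𝓘(ℝ, E) ∞ f x := by
  let φ := chartAt K x
  let ψ := chartAt E (f x)
  let g : K → E := fun u => ψ (f (φ.symm u))
  let U : Set K := φ.target ∩ φ.symm ⁻¹' (f ⁻¹' ψ.source)
  have hU : IsOpen U := φ.isOpen_inter_preimage_symm (ψ.open_source.preimage hf.continuous)
  have hxs : x ∈ φ.source := mem_chart_source K x
  have hxU : φ x ∈ U := by
    refine ⟨φ.map_source hxs, ?_⟩
    rw [mem_preimage, φ.left_inv hxs]
    exact mem_chart_source E (f x)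
  have hg : ContDiffOn ℝ ∞ g U := by
    have h := (contMDiff_iff.1 hf).2 x (f x)
    simp only [mfld_simps] at h
    exact h
  have hgd : fderiv ℝ g (φ x) = mfderiv 𝓘(ℝ, K) 𝓘(ℝ, E) f x := by
    rw [((hf x).mdifferentiableAt (by simp)).mfderiv]
    simp only [modelWithCornersSelf_coe, range_id, fderivWithin_univ]
    rfl
  obtain ⟨T, C, hT⟩ := exists_linearEquiv_inl_eq W hdim (fderiv ℝ g (φ x)) (by rw [hgd]; exact hx)
  -- Adding the complementary directions `C` makes the local representative `g` a map between spaces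
  -- of equal dimension with invertible derivative. Its inverse straightens the image of `g` to `K ×
  -- {0}`.
  have hG : ContDiffOn ℝ ∞ (fun p : K × W => g p.1 + C p.2) (U ×ˢ univ) := by
    refine ContDiffOn.add (hg.comp contDiff_fst.contDiffOn fun p hp => hp.1) ?_
    exact ContDiff.contDiffOn (by fun_prop)
  have hGd : HasFDerivAt (fun p : K × W => g p.1 + C p.2) (T : K × W →L[ℝ] E) (φ x, 0) := by
    have h1 : HasFDerivAt g (fderiv ℝ g (φ x)) ((φ x, (0 : W)).1) :=
      ((hg.contDiffAt (hU.mem_nhds hxU)).differentiableAt (by simp)).hasFDerivAt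
    have h2 := (h1.comp (φ x, (0 : W)) hasFDerivAt_fst).add
      (C.hasFDerivAt.comp (φ x, (0 : W)) hasFDerivAt_snd)
    refine h2.congr_fderiv ?_
    ext p <;> simp [hT]
  have : CompleteSpace (K × W) := FiniteDimensional.complete ℝ _
  obtain ⟨e, he, hxe, heU, hes⟩ := exists_openPartialHomeomorph_contDiffOn
    (hU.prod isOpen_univ) (mk_mem_prod hxU (mem_univ _)) hG T hGd
  have he0 : ∀ u, e (u, 0) = g u := fun u => by rw [he]; simp
  let V : Set M := φ.source ∩ φ ⁻¹' ((fun u => (u, (0 : W))) ⁻¹' e.source)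
  have hV : IsOpen V := φ.isOpen_inter_preimage (e.open_source.preimage (by fun_prop))
  let κ : OpenPartialHomeomorph E E := e.symm ≫ₕ T.toHomeomorph.toOpenPartialHomeomorph
  have hκ : κ ∈ contDiffGroupoid ∞ 𝓘(ℝ, E) := by
    rw [contDiffGroupoid, mem_groupoid_of_pregroupoid]
    constructor
    · refine (T.contDiff.comp_contDiffOn hes).congr_mono (fun y hy => rfl) ?_
      intro y hy
      exact hy.1.1
    · have h2 : ContDiffOn ℝ ∞ e e.source := by
        rw [he]; exact hG.mono heU
      refine h2.comp (f := T.symm) (t := e.source) T.symm.contDiff.contDiffOn ?_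
      intro y hy
      exact hy.1.2
  refine IsImmersionAtOfComplement.mk_of_continuousAt hf.continuous.continuousAt T
    (φ.restr V) (ψ ≫ₕ κ) ?_ ?_ ?_ ?_ ?_
  · rw [φ.restr_source, hV.interior_eq]
    exact ⟨hxs, hxs, hxe⟩
  · refine ⟨mem_chart_source E (f x), ?_, mem_univ _⟩
    have := e.map_source hxe
    rw [he0] at this
    simp only [g, φ.left_inv hxs] at this
    exact this
  · exact restr_mem_maximalAtlas (contDiffGroupoid ∞ 𝓘(ℝ, K))
      (IsManifold.chart_mem_maximalAtlas (I := 𝓘(ℝ, K)) (n := ∞) x) hV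
  · rw [IsManifold.maximalAtlas, mem_maximalAtlas_iff]
    have hψ := IsManifold.chart_mem_maximalAtlas (I := 𝓘(ℝ, E)) (n := ∞) (f x)
    rw [IsManifold.maximalAtlas, mem_maximalAtlas_iff] at hψ
    intro e' he'
    constructor
    · rw [OpenPartialHomeomorph.trans_symm_eq_symm_trans_symm, OpenPartialHomeomorph.trans_assoc]
      exact StructureGroupoid.trans _ (StructureGroupoid.symm _ hκ) (hψ e' he').1
    · rw [← OpenPartialHomeomorph.trans_assoc]
      exact StructureGroupoid.trans _ (hψ e' he').2 hκ
  · intro u hu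
    have hu' : u ∈ (φ.restr V).target := by simpa using hu
    have hu1 : u ∈ φ.target := hu'.1
    have hu2 : (u, (0 : W)) ∈ e.source := by
      have := (interior_subset hu'.2).2
      rwa [mem_preimage, φ.right_inv hu1] at this
    change T (e.symm (ψ (f (φ.symm u)))) = T (u, 0)
    have := e.left_inv hu2
    rw [he0] at this
    exact congrArg T this

end Immersion

/-! ### The boundary curves and the humps of `lower` -/

section Profile

open Real

/-- The lower boundary curve of the region below which `definingFun` is negative. -/
def lower (t : ℝ) : ℝ := sin t ^ 2 / (2 * (t ^ 2 + 1))

/-- The upper boundary curve. -/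
def upper (t : ℝ) : ℝ := 1 / (t ^ 2 + 1)

theorem lower_nonneg (t : ℝ) : 0 ≤ lower t := by unfold lower; positivity

theorem upper_pos (t : ℝ) : 0 < upper t := by unfold upper; positivity

theorem upper_le_one (t : ℝ) : upper t ≤ 1 := by
  unfold upper
  rw [div_le_one (by positivity)]
  nlinarith [sq_nonneg t]

theorem two_mul_lower_le_upper (t : ℝ) : 2 * lower t ≤ upper t := by
  unfold lower upper
  have h : 2 * (sin t ^ 2 / (2 * (t ^ 2 + 1))) = sin t ^ 2 / (t ^ 2 + 1) := by field_simp
  rw [h]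
  exact div_le_div_of_nonneg_right (sin_sq_le_one t) (by positivity)

theorem lower_lt_upper (t : ℝ) : lower t < upper t := by
  have := two_mul_lower_le_upper t
  have := upper_pos t
  linarith

theorem lower_lt_one (t : ℝ) : lower t < 1 :=
  (lower_lt_upper t).trans_le (upper_le_one t)

theorem continuous_lower : Continuous lower := by
  unfold lower
  exact Continuous.div (by fun_prop) (by fun_prop) fun t => by positivity

theorem continuous_upper : Continuous upper := by
  unfold upper
  exact Continuous.div (by fun_prop) (by fun_prop) fun t => by positivity

theorem lower_neg (t : ℝ) : lower (-t) = lower t := by simp [lower]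

theorem upper_neg (t : ℝ) : upper (-t) = upper t := by simp [upper]

theorem lower_nat_mul_pi (n : ℕ) : lower (n * π) = 0 := by simp [lower, sin_nat_mul_pi]

theorem lower_int_mul_pi (n : ℤ) : lower (n * π) = 0 := by simp [lower, sin_int_mul_pi]

theorem upper_le_upper {s t : ℝ} (h : |s| ≤ |t|) : upper t ≤ upper s := by
  unfold upper
  have := sq_le_sq.2 h
  exact one_div_le_one_div_of_le (by positivity) (by linarith)

theorem hasDerivAt_lower (t : ℝ) : HasDerivAt lower
    (sin t * (cos t * (t ^ 2 + 1) - t * sin t) / (t ^ 2 + 1) ^ 2) t := by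
  have h := ((hasDerivAt_sin t).pow 2).div ((((hasDerivAt_id t).pow 2).add_const (1 : ℝ)).const_mul 2)
    (by simp only [id, Pi.pow_apply]; positivity)
  refine h.congr_deriv ?_
  simp only [id, Pi.pow_apply]
  field_simp
  ring

theorem hasDerivAt_upper (t : ℝ) : HasDerivAt upper (-(2 * t) / (t ^ 2 + 1) ^ 2) t := by
  have h := (hasDerivAt_const t (1 : ℝ)).div (((hasDerivAt_id t).pow 2).add_const (1 : ℝ))
    (by simp only [id, Pi.pow_apply]; positivity)
  refine h.congr_deriv ?_
  simp only [id, Pi.pow_apply]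
  field_simp
  ring

/-- Between zeros of `sin`, critical points of `lower` satisfy `cos t = t / (t ^ 2 + 1) * sin t`.
Substituting this in `sin (t₂ - t₁)` expresses `sin d` as `sin t₁ * sin t₂ * d` times a rational
factor at most `1 / 8`. As `sin t₁ * sin t₂ ≤ cos (d / 2) ^ 2`, this gives `tan (d / 2) ≤ d / 16`,
against `tan x > x`. -/
theorem critical_eq_aux {t₁ t₂ : ℝ} (hlt : t₁ < t₂) (hπ : t₂ - t₁ < π)
    (hs : 0 < sin t₁ * sin t₂) (h₁ : cos t₁ * (t₁ ^ 2 + 1) - t₁ * sin t₁ = 0)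
    (h₂ : cos t₂ * (t₂ ^ 2 + 1) - t₂ * sin t₂ = 0) : False := by
  set d := t₂ - t₁ with hd
  have hd0 : 0 < d := by simp only [hd]; linarith
  have e₁ : cos t₁ = t₁ / (t₁ ^ 2 + 1) * sin t₁ := by field_simp; linarith
  have e₂ : cos t₂ = t₂ / (t₂ ^ 2 + 1) * sin t₂ := by field_simp; linarith
  have hsin : sin d = sin t₁ * sin t₂ * (d * ((t₁ * t₂ - 1) / ((t₁ ^ 2 + 1) * (t₂ ^ 2 + 1)))) := by
    rw [hd, sin_sub, e₁, e₂]
    field_simp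
    ring
  have hS : sin t₁ * sin t₂ ≤ (1 + cos d) / 2 := by
    have h1 : cos d = cos t₂ * cos t₁ + sin t₂ * sin t₁ := by rw [hd, cos_sub]
    have h2 := neg_one_le_cos (t₁ + t₂)
    rw [cos_add] at h2
    linarith
  -- With `p = t₁ * t₂` the denominator equals `(p + 1) ^ 2 + (t₁ - t₂) ^ 2`, and `(p + 1) ^ 2 - 8 *
  -- (p - 1) = (p - 3) ^ 2`.
  have hw : (t₁ * t₂ - 1) / ((t₁ ^ 2 + 1) * (t₂ ^ 2 + 1)) ≤ 1 / 8 := by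
    rw [div_le_iff₀ (by positivity)]
    nlinarith [sq_nonneg (t₁ * t₂ - 3), sq_nonneg (t₁ - t₂)]
  have hle : sin d ≤ (1 + cos d) / 2 * (d / 8) := by
    rw [hsin]
    calc _ ≤ sin t₁ * sin t₂ * (d / 8) := by
          refine mul_le_mul_of_nonneg_left ?_ hs.le
          nlinarith
      _ ≤ _ := mul_le_mul_of_nonneg_right hS (by positivity)
  have hc : 0 < cos (d / 2) := cos_pos_of_mem_Ioo ⟨by linarith, by linarith⟩
  have htan : d / 2 * cos (d / 2) < sin (d / 2) := by
    have := lt_tan (x := d / 2) (by linarith) (by linarith)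
    rwa [tan_eq_sin_div_cos, lt_div_iff₀ hc] at this
  have hsd : sin d = 2 * sin (d / 2) * cos (d / 2) := by
    rw [← sin_two_mul]; congr 1; ring
  have hcd : cos d = 2 * cos (d / 2) ^ 2 - 1 := by
    rw [← cos_two_mul]; congr 1; ring
  rw [hsd, hcd] at hle
  nlinarith [mul_pos hd0 hc, mul_pos hc (sub_pos.2 htan), mul_pos (mul_pos hd0 hc) hc]

theorem critical_eq {t₁ t₂ : ℝ} (hπ : |t₂ - t₁| < π)
    (hs : 0 < sin t₁ * sin t₂) (h₁ : deriv lower t₁ = 0) (h₂ : deriv lower t₂ = 0) : t₁ = t₂ := by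
  have key : ∀ t, deriv lower t = 0 → sin t ≠ 0 → cos t * (t ^ 2 + 1) - t * sin t = 0 := by
    intro t ht hst
    rw [(hasDerivAt_lower t).deriv, div_eq_zero_iff] at ht
    rcases ht with ht | ht
    · exact (mul_eq_zero.1 ht).resolve_left hst
    · exact absurd ht (by positivity)
  have k₁ := key t₁ h₁ (left_ne_zero_of_mul hs.ne')
  have k₂ := key t₂ h₂ (right_ne_zero_of_mul hs.ne')
  rcases lt_trichotomy t₁ t₂ with h | h | h
  · exact (critical_eq_aux h ((le_abs_self _).trans_lt hπ) hs k₁ k₂).elim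
  · exact h
  · rw [abs_sub_comm] at hπ
    rw [mul_comm] at hs
    exact (critical_eq_aux h ((le_abs_self _).trans_lt hπ) hs k₂ k₁).elim

theorem sin_mul_sin_pos {n : ℕ} {t₁ t₂ : ℝ} (h₁ : t₁ ∈ Ioo (n * π) ((n + 1) * π))
    (h₂ : t₂ ∈ Ioo (n * π) ((n + 1) * π)) : 0 < sin t₁ * sin t₂ := by
  have e₁ := sin_sub_nat_mul_pi t₁ n
  have e₂ := sin_sub_nat_mul_pi t₂ n
  have p₁ : 0 < sin (t₁ - n * π) := sin_pos_of_pos_of_lt_pi (by linarith [h₁.1]) (by linarith [h₁.2])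
  have p₂ : 0 < sin (t₂ - n * π) := sin_pos_of_pos_of_lt_pi (by linarith [h₂.1]) (by linarith [h₂.2])
  have := mul_pos p₁ p₂
  rw [e₁, e₂] at this
  have hsq : ((-1 : ℝ) ^ n) * (-1) ^ n = 1 := by rw [← mul_pow]; simp
  nlinarith

theorem critical_eq_of_mem {n : ℕ} {t₁ t₂ : ℝ} (h₁ : t₁ ∈ Ioo (n * π) ((n + 1) * π))
    (h₂ : t₂ ∈ Ioo (n * π) ((n + 1) * π)) (d₁ : deriv lower t₁ = 0) (d₂ : deriv lower t₂ = 0) :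
    t₁ = t₂ := by
  refine critical_eq ?_ (sin_mul_sin_pos h₁ h₂) d₁ d₂
  rw [abs_lt]
  constructor <;> linarith [h₁.1, h₁.2, h₂.1, h₂.2]

/-- The maximum over the closed interval is interior because `lower` vanishes at both ends and is
positive at the midpoint. -/
theorem exists_peak (n : ℕ) : ∃ p ∈ Ioo (n * π) ((n + 1) * π), deriv lower p = 0 ∧
    ∀ x ∈ Icc (n * π) ((n + 1) * π), lower x ≤ lower p := by
  have hπ := pi_pos
  obtain ⟨p, hp, hmax⟩ := isCompact_Icc.exists_isMaxOn
    (nonempty_Icc.2 (show n * π ≤ (n + 1) * π by nlinarith)) continuous_lower.continuousOn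
  have hmid : (n * π + π / 2) ∈ Icc (n * π) ((n + 1) * π) := ⟨by linarith, by linarith⟩
  have hpos : 0 < lower p := by
    refine lt_of_lt_of_le ?_ (hmax hmid)
    have : sin (n * π + π / 2) ^ 2 = 1 := by
      rw [sin_add_pi_div_two, cos_sq', sin_nat_mul_pi]; simp
    simp only [lower, this]
    positivity
  have hp' : p ∈ Ioo (n * π) ((n + 1) * π) := by
    refine ⟨lt_of_le_of_ne hp.1 ?_, lt_of_le_of_ne hp.2 ?_⟩
    · rintro rfl
      rw [lower_nat_mul_pi] at hpos
      exact hpos.false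
    · rintro rfl
      have := lower_nat_mul_pi (n + 1)
      push_cast at this
      rw [this] at hpos
      exact hpos.false
  exact ⟨p, hp', (hmax.isLocalMax (Icc_mem_nhds hp'.1 hp'.2)).deriv_eq_zero, fun x hx => hmax hx⟩

/-- The unique maximum point of `lower` in `[nπ, (n+1)π]`. -/
def peak (n : ℕ) : ℝ := (exists_peak n).choose

theorem peak_mem (n : ℕ) : peak n ∈ Ioo (n * π) ((n + 1) * π) := (exists_peak n).choose_spec.1

theorem deriv_lower_peak (n : ℕ) : deriv lower (peak n) = 0 := (exists_peak n).choose_spec.2.1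

theorem lower_le_lower_peak {n : ℕ} {x : ℝ} (hx : x ∈ Icc (n * π) ((n + 1) * π)) :
    lower x ≤ lower (peak n) := (exists_peak n).choose_spec.2.2 x hx

theorem lower_peak_pos (n : ℕ) : 0 < lower (peak n) := by
  refine (lower_nonneg _).lt_of_ne' fun h => ?_
  have h2 : sin (peak n) * sin (peak n) = 0 := by
    unfold lower at h
    rw [div_eq_zero_iff] at h
    rcases h with h | h
    · rw [← h]; ring
    · exact absurd h (by positivity)
  exact (sin_mul_sin_pos (peak_mem n) (peak_mem n)).ne' h2

/-- Shifting the peak left by `π` preserves `sin ^ 2` and shrinks the denominator, so the previous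
hump is strictly higher. -/
theorem lower_peak_succ_lt (n : ℕ) : lower (peak (n + 1)) < lower (peak n) := by
  have h := peak_mem (n + 1)
  push_cast at h
  have hπ := pi_pos
  have h1 : peak (n + 1) - π ∈ Icc (n * π) ((n + 1) * π) :=
    ⟨by linarith [h.1], by linarith [h.2]⟩
  refine lt_of_lt_of_le ?_ (lower_le_lower_peak h1)
  have hpos := lower_peak_pos (n + 1)
  unfold lower at hpos ⊢
  rw [sin_sub_pi, neg_sq]
  have hsin : 0 < sin (peak (n + 1)) ^ 2 := by
    by_contra! hle
    have := div_nonpos_of_nonpos_of_nonneg hle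
      (show (0 : ℝ) ≤ 2 * (peak (n + 1) ^ 2 + 1) by positivity)
    linarith
  refine div_lt_div_of_pos_left hsin (by positivity) ?_
  have hn : (0 : ℝ) ≤ n * π := by positivity
  nlinarith [h.1]

/-- If both sides exceeded `s`, a minimum between the two high points would be an interior critical
point, hence the peak itself by uniqueness; but the peak value is above `s`. So a point at level at
least `lower t` can slide to one end of the interval. -/
theorem lower_le_left_or_right {n : ℕ} {s t : ℝ} (ht : t ∈ Icc (n * π) ((n + 1) * π))
    (hts : lower t ≤ s) :
    (∀ x ∈ Icc (n * π) t, lower x ≤ s) ∨ ∀ x ∈ Icc t ((n + 1) * π), lower x ≤ s := by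
  by_contra! h
  obtain ⟨⟨x, hx, hxs⟩, y, hy, hys⟩ := h
  obtain ⟨z, hz, hmin⟩ := isCompact_Icc.exists_isMinOn
    (nonempty_Icc.2 (hx.2.trans hy.1)) continuous_lower.continuousOn
  have hzs : lower z ≤ s := (hmin (show t ∈ Icc x y from ⟨hx.2, hy.1⟩)).trans hts
  have hz' : z ∈ Ioo x y := by
    refine ⟨lt_of_le_of_ne hz.1 ?_, lt_of_le_of_ne hz.2 ?_⟩ <;> rintro rfl <;> linarith
  have hd : deriv lower z = 0 := (hmin.isLocalMin (Icc_mem_nhds hz'.1 hz'.2)).deriv_eq_zero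
  have heq := critical_eq_of_mem (n := n) ⟨hx.1.trans_lt hz'.1, hz'.2.trans_le hy.2⟩ (peak_mem n)
    hd (deriv_lower_peak n)
  have := lower_le_lower_peak ⟨hx.1, hx.2.trans ht.2⟩
  rw [heq] at hzs
  linarith

theorem exists_nat_mul_pi_mem {t : ℝ} (ht : 0 ≤ t) : ∃ n : ℕ, t ∈ Ico (n * π) ((n + 1) * π) := by
  have hπ := pi_pos
  refine ⟨⌊t / π⌋₊, ?_, ?_⟩
  · rw [← le_div_iff₀ hπ]
    exact Nat.floor_le (by positivity)
  · rw [← div_lt_iff₀ hπ]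
    exact Nat.lt_floor_add_one _

theorem eq_of_deriv_lower_eq_zero {t : ℝ} (ht : 0 ≤ t) (hd : deriv lower t = 0) :
    ∃ n : ℕ, t = n * π ∨ t = peak n := by
  obtain ⟨n, hn⟩ := exists_nat_mul_pi_mem ht
  refine ⟨n, ?_⟩
  rcases hn.1.eq_or_lt with h | h
  · exact Or.inl h.symm
  · exact Or.inr (critical_eq_of_mem ⟨h, hn.2⟩ (peak_mem n) hd (deriv_lower_peak n))

end Profile

/-! ### An integral separating the components of the slices -/

section Label

open Real

/-- The integrand measuring by how much `lower` exceeds the level `s`. -/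
def excess (s x : ℝ) : ℝ := max (sin x ^ 2 - 2 * s * (x ^ 2 + 1)) 0

theorem excess_nonneg (s x : ℝ) : 0 ≤ excess s x := le_max_right _ _

theorem excess_eq_zero_iff {s x : ℝ} : excess s x = 0 ↔ lower x ≤ s := by
  unfold excess lower
  rw [max_eq_right_iff, div_le_iff₀ (by positivity)]
  constructor <;> intro h <;> linarith

theorem continuous_excess (s : ℝ) : Continuous (excess s) := by
  unfold excess
  fun_prop

/-- A function which is constant on the intervals where `lower ≤ s` and separates them. -/
def label (s t : ℝ) : ℝ := ∫ x in (0 : ℝ)..t, excess s x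

theorem continuous_label : Continuous fun p : ℝ × ℝ => label p.1 p.2 := by
  have h : Continuous (Function.uncurry fun (p : ℝ × ℝ) x => excess p.1 x) := by
    unfold Function.uncurry excess
    fun_prop
  exact intervalIntegral.continuous_parametric_intervalIntegral_of_continuous h continuous_snd

theorem intervalIntegrable_excess (s a b : ℝ) :
    IntervalIntegrable (excess s) MeasureTheory.volume a b :=
  (continuous_excess s).intervalIntegrable a b

theorem label_sub (s a b : ℝ) : label s b - label s a = ∫ x in a..b, excess s x :=
  intervalIntegral.integral_interval_sub_left (intervalIntegrable_excess s 0 b)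
    (intervalIntegrable_excess s 0 a)

theorem label_mono (s : ℝ) : Monotone (label s) := by
  intro a b h
  rw [← sub_nonneg, label_sub]
  exact intervalIntegral.integral_nonneg h fun x _ => excess_nonneg s x

/-- The integrand is continuous and nonnegative, so its integral over `[a, b]` vanishes only if it
vanishes identically there. -/
theorem label_eq_iff {s a b : ℝ} (h : a < b) :
    label s a = label s b ↔ ∀ x ∈ Icc a b, lower x ≤ s := by
  rw [eq_comm, ← sub_eq_zero, label_sub]
  constructor
  · intro h0 x hx
    by_contra hlt
    rw [← excess_eq_zero_iff] at hlt
    exact (intervalIntegral.integral_pos h (continuous_excess s).continuousOn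
      (fun y _ => excess_nonneg s y) ⟨x, hx, (excess_nonneg s x).lt_of_ne' hlt⟩).ne' h0
  · intro hx
    rw [intervalIntegral.integral_congr (g := fun _ => (0 : ℝ)), intervalIntegral.integral_zero]
    intro x hx'
    rw [uIcc_of_le h.le] at hx'
    exact excess_eq_zero_iff.2 (hx x hx')

theorem label_zero (s : ℝ) : label s 0 = 0 := intervalIntegral.integral_same

theorem label_neg (s t : ℝ) : label s (-t) = -label s t := by
  have h := intervalIntegral.integral_comp_neg (a := 0) (b := t) (excess s)
  have he : ∀ x, excess s (-x) = excess s x := fun x => by simp [excess]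
  simp only [he, neg_zero] at h
  unfold label
  rw [h, intervalIntegral.integral_symm]

theorem label_antitone {s s' t : ℝ} (h : s ≤ s') (ht : 0 ≤ t) : label s' t ≤ label s t := by
  refine intervalIntegral.integral_mono ht (intervalIntegrable_excess _ _ _)
    (intervalIntegrable_excess _ _ _) fun x => ?_
  refine max_le_max ?_ le_rfl
  nlinarith [sq_nonneg x]

/-- This is the source of properness and local finiteness. By monotonicity one may raise the level
to `upper t` and stop at `t / 2`: the integral of `sin ^ 2` up to there is at least `t / 4 - 1 / 4`,
while the subtracted term costs at most `t / 12 + 1 / 2`. Integrating the unclipped expression up to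
`t` itself would give a useless bound. -/
theorem le_label {s t : ℝ} (ht : 0 ≤ t) (hs : s ≤ upper t) : t / 12 - 1 ≤ label s t := by
  have h1 : label (upper t) (t / 2) ≤ label s t :=
    (label_mono _ (by linarith)).trans (label_antitone hs ht)
  refine le_trans ?_ h1
  have h2 : ∫ x in (0 : ℝ)..(t / 2), (sin x ^ 2 - 2 * upper t * (x ^ 2 + 1)) ≤
      label (upper t) (t / 2) := by
    refine intervalIntegral.integral_mono (by linarith) (Continuous.intervalIntegrable
      (by fun_prop) _ _) (intervalIntegrable_excess _ _ _) fun x => le_max_left _ _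
  refine le_trans ?_ h2
  rw [intervalIntegral.integral_sub (Continuous.intervalIntegrable (by fun_prop) _ _)
    (Continuous.intervalIntegrable (by fun_prop) _ _), intervalIntegral.integral_const_mul,
    intervalIntegral.integral_add (Continuous.intervalIntegrable (by fun_prop) _ _)
    (Continuous.intervalIntegrable (by fun_prop) _ _), integral_pow, integral_sin_sq]
  simp only [intervalIntegral.integral_const, sin_zero, cos_zero, smul_eq_mul]
  have hsc : sin (t / 2) * cos (t / 2) ≤ 1 / 2 := by
    nlinarith [sq_nonneg (sin (t / 2) - cos (t / 2)), sin_sq_add_cos_sq (t / 2)]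
  have hu : 2 * upper t * ((t / 2) ^ 3 / 3 + t / 2) ≤ t / 12 + 1 / 2 := by
    unfold upper
    rw [mul_one_div, div_mul_eq_mul_div, div_le_iff₀ (by positivity)]
    nlinarith [sq_nonneg (t - 1), mul_nonneg ht (sq_nonneg t)]
  norm_num at hu ⊢
  nlinarith

end Label

/-! ### The planar tree formed by the values of `label` -/

section Tree

open Real

/-- The planar region between the curves `lower` and `upper`, in coordinates `(x₁, x₂)`. -/
def region : Set (ℝ × ℝ) := {p | lower p.2 ≤ p.1 ∧ p.1 ≤ upper p.2}

theorem region_fst_mem {p : ℝ × ℝ} (hp : p ∈ region) : p.1 ∈ Icc (0 : ℝ) 1 :=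
  ⟨(lower_nonneg _).trans hp.1, hp.2.trans (upper_le_one _)⟩

theorem abs_label (s t : ℝ) : |label s t| = label s |t| := by
  have h : ∀ t, 0 ≤ t → 0 ≤ label s t := fun t ht => by
    rw [← label_zero s]; exact label_mono s ht
  rcases le_total 0 t with ht | ht
  · rw [abs_of_nonneg ht, abs_of_nonneg (h t ht)]
  · rw [abs_of_nonpos ht, label_neg, abs_of_nonpos]
    have := h (-t) (by linarith)
    rw [label_neg] at this
    linarith

theorem abs_le_of_abs_label_le {p : ℝ × ℝ} (hp : p ∈ region) {C : ℝ} (h : |label p.1 p.2| ≤ C) :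
    |p.2| ≤ 12 * (C + 1) := by
  rw [abs_label] at h
  have hu : p.1 ≤ upper |p.2| := by
    refine hp.2.trans (upper_le_upper ?_)
    rw [abs_abs]
  have := le_label (abs_nonneg p.2) hu
  linarith

/-- The value of `label` on the component containing `ℓ * π`. -/
def branch (l : ℤ) (s : ℝ) : ℝ := label s (l * π)

theorem continuous_branch (l : ℤ) : Continuous (branch l) :=
  continuous_label.comp (by fun_prop : Continuous fun s : ℝ => (s, (l : ℝ) * π))

theorem branch_neg (l : ℤ) (s : ℝ) : branch (-l) s = -branch l s := by
  unfold branch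
  rw [← label_neg]
  push_cast
  ring_nf

theorem branch_mono {l l' : ℤ} (h : l ≤ l') (s : ℝ) : branch l s ≤ branch l' s := by
  refine label_mono s (mul_le_mul_of_nonneg_right ?_ pi_pos.le)
  exact_mod_cast h

/-- The level at which the component of `n * π` merges with that of `(n - 1) * π`. -/
def stemTop : ℕ → ℝ
  | 0 => 1
  | n + 1 => lower (peak n)

theorem stemTop_pos : ∀ n, 0 < stemTop n
  | 0 => one_pos
  | n + 1 => lower_peak_pos n

theorem stemTop_succ_lt : ∀ n, stemTop (n + 1) < stemTop n
  | 0 => lower_lt_one _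
  | n + 1 => lower_peak_succ_lt n

theorem stemTop_le_one (n : ℕ) : stemTop n ≤ 1 :=
  (strictAnti_nat_of_succ_lt stemTop_succ_lt).antitone (Nat.zero_le n)

/-- The components of `n * π` and `(n + 1) * π` are joined exactly when the level clears the hump
between them. -/
theorem branch_succ_eq_iff (n : ℕ) (s : ℝ) :
    branch n s = branch (n + 1) s ↔ stemTop (n + 1) ≤ s := by
  have hπ := pi_pos
  unfold branch stemTop
  push_cast
  rw [label_eq_iff (by nlinarith)]
  exact ⟨fun h => h _ (Ioo_subset_Icc_self (peak_mem n)),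
    fun h x hx => (lower_le_lower_peak hx).trans h⟩

/-- The level `s` lies on the stem of the branch `l`, below the merging level. -/
def OnStem (l : ℤ) (s : ℝ) : Prop := l = 0 ∨ s < stemTop l.natAbs

theorem onStem_neg {l : ℤ} {s : ℝ} : OnStem (-l) s ↔ OnStem l s := by simp [OnStem]

/-- On its stem the branch `l' = n + 1` has not yet merged with `n`, and every smaller index has
value at most that of `n`. -/
theorem branch_lt_of_onStem {l l' : ℤ} {s : ℝ} (h : l < l') (hl' : 0 < l') (hs : OnStem l' s) :
    branch l s < branch l' s := by
  obtain ⟨n, rfl⟩ : ∃ n : ℕ, l' = n + 1 := ⟨(l' - 1).toNat, by omega⟩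
  have h1 : branch l s ≤ branch n s := branch_mono (by omega) s
  refine h1.trans_lt ((branch_mono (by omega) s).lt_of_ne fun heq => ?_)
  rw [branch_succ_eq_iff] at heq
  rcases hs with hs | hs
  · omega
  · rw [show ((n : ℤ) + 1).natAbs = n + 1 by omega] at hs
    linarith

theorem branch_strictMono_of_onStem {l l' : ℤ} {s : ℝ} (h : l < l') (hl : OnStem l s)
    (hl' : OnStem l' s) : branch l s < branch l' s := by
  rcases lt_or_ge 0 l' with h0 | h0
  · exact branch_lt_of_onStem h h0 hl'
  · have := branch_lt_of_onStem (l := -l') (l' := -l) (s := s) (by omega) (by omega)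
      (onStem_neg.2 hl)
    rw [branch_neg, branch_neg] at this
    linarith

theorem eq_of_branch_eq {l l' : ℤ} {s : ℝ} (hl : OnStem l s) (hl' : OnStem l' s)
    (h : branch l s = branch l' s) : l = l' := by
  rcases lt_trichotomy l l' with hlt | heq | hlt
  · exact absurd h (branch_strictMono_of_onStem hlt hl hl').ne
  · exact heq
  · exact absurd h (branch_strictMono_of_onStem hlt hl' hl).ne'

/-- Each branch value is represented by an index that has not yet merged: descend towards `0` as
long as the level clears the inner hump. -/
theorem exists_onStem_nat (n : ℕ) (s : ℝ) : ∃ k : ℕ, OnStem k s ∧ branch n s = branch k s := by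
  induction n with
  | zero => exact ⟨0, Or.inl rfl, rfl⟩
  | succ n ih =>
    by_cases h : stemTop (n + 1) ≤ s
    · obtain ⟨k, hk, hk'⟩ := ih
      refine ⟨k, hk, ?_⟩
      rw [← hk']
      push_cast
      exact ((branch_succ_eq_iff n s).2 h).symm
    · refine ⟨n + 1, Or.inr ?_, rfl⟩
      rw [Int.natAbs_natCast]
      exact not_le.1 h

theorem exists_onStem (l : ℤ) (s : ℝ) : ∃ k : ℤ, OnStem k s ∧ branch l s = branch k s := by
  obtain ⟨n, rfl | rfl⟩ := l.eq_nat_or_neg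
  · obtain ⟨k, hk⟩ := exists_onStem_nat n s
    exact ⟨k, hk⟩
  · obtain ⟨k, hk, hk'⟩ := exists_onStem_nat n s
    exact ⟨-k, onStem_neg.2 hk, by rw [branch_neg, branch_neg, hk']⟩

/-- The loss of one in `natAbs - 1` arises because `s` may exceed `upper` at the multiple of `π`
itself; the bound `le_label` is applied one multiple closer to the origin, where `s ≤ lower (peak n)
< upper (peak n)` ensures `s ≤ upper (n * π)`. -/
theorem le_abs_branch {l : ℤ} {s : ℝ} (hs : s ≤ stemTop l.natAbs) :
    ((l.natAbs : ℝ) - 1) * π / 12 - 1 ≤ |branch l s| := by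
  have hπ := pi_pos
  have habs : |branch l s| = label s (l.natAbs * π) := by
    rw [branch, abs_label, abs_mul, abs_of_pos hπ, Nat.cast_natAbs]
    simp
  rw [habs]
  rcases hl : l.natAbs with _ | n
  · have : label s ((0 : ℕ) * π) = 0 := by simp [label_zero]
    rw [this]
    push_cast
    linarith
  · rw [hl] at hs
    have h1 : s ≤ upper (n * π) := by
      have hp := (peak_mem n).1
      have hn : (0 : ℝ) ≤ n * π := by positivity
      refine (hs.trans (lower_lt_upper _).le).trans (upper_le_upper ?_)
      rw [abs_of_nonneg hn, abs_of_nonneg (hn.trans hp.le)]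
      exact hp.le
    have h2 := le_label (by positivity) h1
    have h3 : label s (n * π) ≤ label s ((n + 1 : ℕ) * π) := by
      refine label_mono s ?_
      push_cast
      nlinarith
    push_cast at h3 ⊢
    linarith

/-- Having one hump per interval, a point under level `s` is joined below `s` to an adjacent
multiple of `π`; negative `t` follows by symmetry. -/
theorem exists_branch_eq_label {s t : ℝ} (h : lower t ≤ s) : ∃ l : ℤ, label s t = branch l s := by
  wlog ht : 0 ≤ t generalizing t
  · obtain ⟨l, hl⟩ := this (t := -t) (by rwa [lower_neg]) (by linarith)
    refine ⟨-l, ?_⟩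
    rw [branch_neg, ← hl, label_neg, neg_neg]
  · obtain ⟨n, hn⟩ := exists_nat_mul_pi_mem ht
    rcases hn.1.eq_or_lt with he | hlt
    · exact ⟨n, by rw [branch, ← he]; push_cast; rfl⟩
    rcases lower_le_left_or_right (Ico_subset_Icc_self hn) h with h1 | h1
    · exact ⟨n, ((label_eq_iff hlt).2 h1).symm⟩
    · refine ⟨n + 1, ?_⟩
      unfold branch
      push_cast
      exact (label_eq_iff hn.2).2 h1

/-- If `(s, l * π)` lies above the region, replace it by the point `±T` of the upper curve at height
`s`. Beyond `|t| = T` one has `lower ≤ upper ≤ s`, so the label does not change. -/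
theorem exists_label_eq_branch {s : ℝ} (hs : s ∈ Icc (0 : ℝ) 1) (l : ℤ) :
    ∃ t, (s, t) ∈ region ∧ label s t = branch l s := by
  by_cases hl : s ≤ upper (l * π)
  · exact ⟨l * π, ⟨by simpa [lower_int_mul_pi] using hs.1, hl⟩, rfl⟩
  push Not at hl
  have hs0 : 0 < s := (upper_pos _).trans hl
  set T := √(1 / s - 1) with hT
  have hT0 : 0 ≤ T := sqrt_nonneg _
  have hT2 : T ^ 2 = 1 / s - 1 := by
    rw [hT, sq_sqrt]
    rw [sub_nonneg, le_div_iff₀ hs0]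
    linarith [hs.2]
  have huT : upper T = s := by
    rw [upper, hT2]
    field_simp
    ring
  have hlt : T < |(l : ℝ) * π| := by
    by_contra! hle
    have := upper_le_upper (s := l * π) (t := T) (by rwa [abs_of_nonneg hT0])
    rw [huT] at this
    linarith
  have hlow : ∀ x, T ≤ |x| → lower x ≤ s := fun x hx => by
    rw [← huT]
    exact (lower_lt_upper x).le.trans (upper_le_upper (by rwa [abs_of_nonneg hT0]))
  rcases le_total 0 ((l : ℝ) * π) with h0 | h0
  · rw [abs_of_nonneg h0] at hlt
    refine ⟨T, ⟨hlow T (le_abs_self T), huT.ge⟩, (label_eq_iff hlt).2 fun x hx => ?_⟩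
    exact hlow x (hx.1.trans (le_abs_self x))
  · rw [abs_of_nonpos h0] at hlt
    refine ⟨-T, ⟨hlow _ (by rw [abs_neg]; exact le_abs_self T), by simp [upper_neg, huT]⟩, ?_⟩
    refine ((label_eq_iff (by linarith)).2 fun x hx => ?_).symm
    refine hlow x (le_trans ?_ (neg_le_abs x))
    linarith [hx.2]

/-- The model of the Reeb graph, as a subset of the plane. -/
def tree : Set (ℝ × ℝ) := {p | p.1 ∈ Icc (0 : ℝ) 1 ∧ ∃ l : ℤ, p.2 = branch l p.1}

theorem image_region : (fun p : ℝ × ℝ => (p.1, label p.1 p.2)) '' region = tree := by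
  ext ⟨s, y⟩
  constructor
  · rintro ⟨p, hp, h⟩
    obtain ⟨rfl, rfl⟩ := Prod.mk.inj h
    have h01 := region_fst_mem hp
    exact ⟨h01, exists_branch_eq_label hp.1⟩
  · rintro ⟨hs, l, hl⟩
    obtain ⟨t, ht, ht'⟩ := exists_label_eq_branch hs l
    exact ⟨(s, t), ht, Prod.ext rfl (ht'.trans hl.symm)⟩

end Tree

/-! ### Components of the horizontal slices of the region -/

section Slice

/-- The product whose zeros are the boundary points of the slices of `region`. -/
def slice (s t : ℝ) : ℝ := (s - lower t) * (upper t - s)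

theorem slice_nonneg_iff {s t : ℝ} : 0 ≤ slice s t ↔ (s, t) ∈ region := by
  have h := lower_lt_upper t
  unfold slice region
  constructor
  · intro h0
    constructor
    · by_contra! hlt
      dsimp only at hlt
      nlinarith
    · by_contra! hlt
      dsimp only at hlt
      nlinarith
  · rintro ⟨h1, h2⟩
    exact mul_nonneg (sub_nonneg.2 h1) (sub_nonneg.2 h2)

theorem continuous_slice : Continuous fun p : ℝ × ℝ => slice p.1 p.2 := by
  have := continuous_lower
  have := continuous_upper
  unfold slice
  fun_prop

/-- Only `lower` can disconnect a slice: `upper` decreases in `|t|`, so the upper bound on an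
interval follows from its endpoints. -/
theorem mem_region_of_mem_Icc {s a b t : ℝ} (ha : (s, a) ∈ region) (hb : (s, b) ∈ region)
    (h : ∀ x ∈ Icc a b, lower x ≤ s) (ht : t ∈ Icc a b) : (s, t) ∈ region := by
  refine ⟨h t ht, ?_⟩
  dsimp only
  rcases le_total 0 t with h0 | h0
  · exact hb.2.trans (upper_le_upper (by
      rw [abs_of_nonneg h0, abs_of_nonneg (h0.trans ht.2)]; exact ht.2))
  · exact ha.2.trans (upper_le_upper (by
      rw [abs_of_nonpos h0, abs_of_nonpos (ht.1.trans h0)]; linarith [ht.1]))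

theorem label_eq_of_Icc_subset {s a b : ℝ} (hab : a ≤ b)
    (h : ∀ x ∈ Icc a b, lower x ≤ s) : label s a = label s b := by
  rcases hab.eq_or_lt with rfl | hlt
  · rfl
  · exact (label_eq_iff hlt).2 h

/-- The part of a horizontal slice of `region` on which `label` is constant is a compact interval
whose endpoints lie on the boundary of the region. -/
theorem exists_fiber_eq_Icc {s t : ℝ} (ht : (s, t) ∈ region) : ∃ a b, a ≤ b ∧
    (∀ t', t' ∈ Icc a b ↔ (s, t') ∈ region ∧ label s t' = label s t) ∧
    slice s a = 0 ∧ slice s b = 0 := by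
  let I : Set ℝ := {t' | (s, t') ∈ region ∧ label s t' = label s t}
  have hcl : IsClosed I := by
    have h1 : IsClosed {t' | 0 ≤ slice s t'} :=
      isClosed_le continuous_const (continuous_slice.comp (by fun_prop : Continuous fun t' : ℝ => (s, t')))
    have h2 : IsClosed {t' | label s t' = label s t} :=
      isClosed_eq (continuous_label.comp (by fun_prop : Continuous fun t' : ℝ => (s, t')))
        continuous_const
    convert h1.inter h2 using 1
    ext t'
    simp only [I, mem_ofPred_eq, mem_inter_iff, slice_nonneg_iff]
  have hbd : ∀ t' ∈ I, |t'| ≤ 12 * (|label s t| + 1) := fun t' ht' =>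
    abs_le_of_abs_label_le (p := (s, t')) ht'.1 (by rw [ht'.2])
  have hne : I.Nonempty := ⟨t, ht, rfl⟩
  have hbb : BddBelow I := ⟨_, fun t' ht' => (abs_le.1 (hbd t' ht')).1⟩
  have hba : BddAbove I := ⟨_, fun t' ht' => (abs_le.1 (hbd t' ht')).2⟩
  have ha := hcl.csInf_mem hne hbb
  have hb := hcl.csSup_mem hne hba
  set a := sInf I
  set b := sSup I
  have hab : a ≤ b := csInf_le hbb hb
  have hlow : ∀ x ∈ Icc a b, lower x ≤ s := by
    rcases hab.eq_or_lt with heq | hlt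
    · intro x hx
      have : x = a := le_antisymm (hx.2.trans heq.ge) hx.1
      rw [this]
      exact ha.1.1
    · exact (label_eq_iff hlt).1 (ha.2.trans hb.2.symm)
  -- Where `slice` is positive the fibre contains a neighbourhood, so `slice` must vanish at the
  -- infimum and at the supremum.
  have hext : ∀ c ∈ I, 0 < slice s c → ∃ ε > 0, Icc (c - ε) (c + ε) ⊆ I := by
    intro c hc hpos
    have hev : ∀ᶠ x in 𝓝 c, 0 < slice s x :=
      (continuous_slice.comp (by fun_prop : Continuous fun t' : ℝ => (s, t'))).continuousAt.eventually
        (lt_mem_nhds hpos)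
    obtain ⟨ε, hε, hball⟩ := Metric.eventually_nhds_iff_ball.1 hev
    have hreg : ∀ x ∈ Icc (c - ε / 2) (c + ε / 2), (s, x) ∈ region := fun x hx =>
      slice_nonneg_iff.1 (hball x (by
        rw [Metric.mem_ball, Real.dist_eq, abs_lt]; constructor <;> linarith [hx.1, hx.2])).le
    refine ⟨ε / 2, by positivity, fun x hx => ⟨hreg x hx, ?_⟩⟩
    rw [← hc.2]
    rcases le_total x c with h | h
    · exact label_eq_of_Icc_subset h fun y hy =>
        (hreg y ⟨hx.1.trans hy.1, by linarith [hy.2]⟩).1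
    · exact (label_eq_of_Icc_subset h fun y hy =>
        (hreg y ⟨by linarith [hy.1], hy.2.trans hx.2⟩).1).symm
  refine ⟨a, b, hab, fun t' => ⟨fun ht' => ?_, fun ht' => ⟨csInf_le hbb ht', le_csSup hba ht'⟩⟩,
    ?_, ?_⟩
  · refine ⟨mem_region_of_mem_Icc ha.1 hb.1 hlow ht', ?_⟩
    rw [← ha.2]
    exact (label_eq_of_Icc_subset ht'.1 fun x hx => hlow x ⟨hx.1, hx.2.trans ht'.2⟩).symm
  · by_contra hne0
    obtain ⟨ε, hε, hsub⟩ := hext a ha ((slice_nonneg_iff.2 ha.1).lt_of_ne' hne0)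
    have := csInf_le hbb (hsub (left_mem_Icc.2 (by linarith)))
    linarith
  · by_contra hne0
    obtain ⟨ε, hε, hsub⟩ := hext b hb ((slice_nonneg_iff.2 hb.1).lt_of_ne' hne0)
    have := le_csSup hba (hsub (right_mem_Icc.2 (by linarith)))
    linarith

end Slice

/-! ### CW structures from vertices and locally finite arcs -/

section GraphData

universe u

/-- A decomposition of a space into vertices and locally finitely many arcs joining them. -/
structure GraphData (X : Type u) [TopologicalSpace X] where
  V : Set X
  ι : Type u
  arc : ι → ℝ → X
  continuousOn_arc : ∀ i, ContinuousOn (arc i) (Icc (-1) 1)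
  injOn_arc : ∀ i, InjOn (arc i) (Icc (-1) 1)
  left_mem : ∀ i, arc i (-1) ∈ V
  right_mem : ∀ i, arc i 1 ∈ V
  arc_notMem : ∀ i, ∀ t ∈ Ioo (-1 : ℝ) 1, arc i t ∉ V
  eq_of_arc_eq : ∀ i j, ∀ t ∈ Ioo (-1 : ℝ) 1, ∀ t' ∈ Ioo (-1 : ℝ) 1, arc i t = arc j t' → i = j
  cover : ∀ x, x ∈ V ∨ ∃ i, ∃ t ∈ Icc (-1 : ℝ) 1, arc i t = x
  locallyFinite_vertex : LocallyFinite fun v : V => ({(v : X)} : Set X)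
  locallyFinite_arc : LocallyFinite fun i => arc i '' Icc (-1) 1

theorem mem_ball_fin_one {f : Fin 1 → ℝ} : f ∈ Metric.ball (0 : Fin 1 → ℝ) 1 ↔ f 0 ∈ Ioo (-1) 1 := by
  rw [mem_ball_zero_iff, pi_norm_lt_iff one_pos]
  simp [abs_lt]

theorem mem_closedBall_fin_one {f : Fin 1 → ℝ} :
    f ∈ Metric.closedBall (0 : Fin 1 → ℝ) 1 ↔ f 0 ∈ Icc (-1) 1 := by
  rw [mem_closedBall_zero_iff, pi_norm_le_iff_of_nonneg zero_le_one]
  simp [abs_le]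

theorem mem_sphere_fin_one {f : Fin 1 → ℝ} (hf : f ∈ Metric.sphere (0 : Fin 1 → ℝ) 1) :
    f 0 = -1 ∨ f 0 = 1 := by
  have h1 := mem_closedBall_fin_one.1 (Metric.sphere_subset_closedBall hf)
  by_contra! h
  have h2 : f ∈ Metric.ball (0 : Fin 1 → ℝ) 1 :=
    mem_ball_fin_one.2 ⟨h1.1.lt_of_ne' h.1, h1.2.lt_of_ne h.2⟩
  exact (Metric.sphere_disjoint_ball.le_bot ⟨hf, h2⟩)

theorem image_eval_ball {X : Type*} (p : ℝ → X) :
    (fun f : Fin 1 → ℝ => p (f 0)) '' Metric.ball 0 1 = p '' Ioo (-1) 1 := by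
  ext x
  constructor
  · rintro ⟨f, hf, rfl⟩
    exact ⟨f 0, mem_ball_fin_one.1 hf, rfl⟩
  · rintro ⟨t, ht, rfl⟩
    exact ⟨fun _ => t, mem_ball_fin_one.2 ht, rfl⟩

theorem image_eval_closedBall {X : Type*} (p : ℝ → X) :
    (fun f : Fin 1 → ℝ => p (f 0)) '' Metric.closedBall 0 1 = p '' Icc (-1) 1 := by
  ext x
  constructor
  · rintro ⟨f, hf, rfl⟩
    exact ⟨f 0, mem_closedBall_fin_one.1 hf, rfl⟩
  · rintro ⟨t, ht, rfl⟩
    exact ⟨fun _ => t, mem_closedBall_fin_one.2 ht, rfl⟩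

namespace GraphData

variable {X : Type u} [TopologicalSpace X] (D : GraphData X)

/-- The cells of the CW structure. -/
def Cell : ℕ → Type u
  | 0 => D.V
  | 1 => D.ι
  | _ + 2 => PEmpty

theorem injOn_eval (i : D.ι) :
    InjOn (fun f : Fin 1 → ℝ => D.arc i (f 0)) (Metric.closedBall 0 1) := by
  intro f hf g hg h
  have := D.injOn_arc i (mem_closedBall_fin_one.1 hf) (mem_closedBall_fin_one.1 hg) h
  ext k
  rw [Subsingleton.elim k 0]
  exact this

theorem continuousOn_eval (i : D.ι) :
    ContinuousOn (fun f : Fin 1 → ℝ => D.arc i (f 0)) (Metric.closedBall 0 1) :=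
  (D.continuousOn_arc i).comp (continuous_apply 0).continuousOn
    fun _ hf => mem_closedBall_fin_one.1 hf

/-- The characteristic maps of the CW structure. -/
def charMap : (n : ℕ) → D.Cell n → PartialEquiv (Fin n → ℝ) X
  | 0, v => InjOn.toPartialEquiv (fun _ => v.1) (Metric.ball 0 1)
      (fun _ _ _ _ _ => Subsingleton.elim _ _)
  | 1, i => InjOn.toPartialEquiv (fun f => D.arc i (f 0)) (Metric.ball 0 1)
      ((D.injOn_eval i).mono Metric.ball_subset_closedBall)
  | _ + 2, e => e.elim

theorem charMap_zero_image (v : D.V) {s : Set (Fin 0 → ℝ)} (hs : (0 : Fin 0 → ℝ) ∈ s) :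
    D.charMap 0 v '' s = {(v : X)} := by
  change (fun _ => (v : X)) '' s = _
  exact Set.Nonempty.image_const ⟨0, hs⟩ _

theorem charMap_zero_ball (v : D.V) : D.charMap 0 v '' Metric.ball 0 1 = {(v : X)} :=
  D.charMap_zero_image v (Metric.mem_ball_self one_pos)

theorem charMap_zero_closedBall (v : D.V) : D.charMap 0 v '' Metric.closedBall 0 1 = {(v : X)} :=
  D.charMap_zero_image v (Metric.mem_closedBall_self zero_le_one)

theorem charMap_one_ball (i : D.ι) : D.charMap 1 i '' Metric.ball 0 1 = D.arc i '' Ioo (-1) 1 :=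
  image_eval_ball _

theorem charMap_one_closedBall (i : D.ι) :
    D.charMap 1 i '' Metric.closedBall 0 1 = D.arc i '' Icc (-1) 1 :=
  image_eval_closedBall _

theorem locallyFinite_cells : LocallyFinite
    fun p : Σ n, D.Cell n => D.charMap p.1 p.2 '' Metric.closedBall 0 1 := by
  intro x
  obtain ⟨U, hU, hUf⟩ := D.locallyFinite_vertex x
  obtain ⟨W, hW, hWf⟩ := D.locallyFinite_arc x
  refine ⟨U ∩ W, Filter.inter_mem hU hW, ((hUf.image fun v => (⟨0, v⟩ : Σ n, D.Cell n)).union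
    (hWf.image fun i => (⟨1, i⟩ : Σ n, D.Cell n))).subset ?_⟩
  rintro ⟨n, c⟩ ⟨y, hy, hyU, hyW⟩
  match n, c with
  | 0, v =>
    replace hy := (D.charMap_zero_closedBall v).subset hy
    exact Or.inl ⟨v, ⟨y, hy, hyU⟩, rfl⟩
  | 1, i =>
    replace hy := (D.charMap_one_closedBall i).subset hy
    exact Or.inr ⟨i, ⟨y, hy, hyW⟩, rfl⟩

/-- The CW structure given by a decomposition into vertices and arcs. -/
@[reducible]
def cwComplex [T2Space X] : CWComplex (univ : Set X) where
  cell := D.Cell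
  map := D.charMap
  source_eq n c := match n, c with
    | 0, _ => rfl
    | 1, _ => rfl
  continuousOn n c := match n, c with
    | 0, v => (continuous_const (y := (v.1 : X))).continuousOn
    | 1, i => D.continuousOn_eval i
  continuousOn_symm n c := match n, c with
    | 0, v => (continuous_of_const fun _ _ => Subsingleton.elim _ _).continuousOn
    | 1, i => by
      rw [continuousOn_iff_isClosed]
      intro C hC
      -- On the compact closed ball the arc is continuous and injective, so images of closed subsets
      -- are compact, hence closed; this gives continuity of the inverse.
      refine ⟨(fun f : Fin 1 → ℝ => D.arc i (f 0)) '' (C ∩ Metric.closedBall 0 1), ?_, ?_⟩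
      · refine (((isCompact_closedBall 0 1).inter_left hC).image_of_continuousOn
          ((D.continuousOn_eval i).mono inter_subset_right)).isClosed
      · ext x
        constructor
        · rintro ⟨hxC, hx⟩
          refine ⟨⟨_, ⟨hxC, ?_⟩, (D.charMap 1 i).right_inv hx⟩, hx⟩
          exact Metric.ball_subset_closedBall ((D.charMap 1 i).map_target hx)
        · rintro ⟨⟨f, hf, rfl⟩, hx⟩
          refine ⟨?_, hx⟩
          have h1 := (D.charMap 1 i).right_inv hx
          have h2 : (D.charMap 1 i).symm (D.arc i (f 0)) = f :=
            D.injOn_eval i (Metric.ball_subset_closedBall ((D.charMap 1 i).map_target hx)) hf.2 h1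
          rw [mem_preimage, h2]
          exact hf.1
  pairwiseDisjoint' := by
    rintro ⟨n, c⟩ - ⟨n', c'⟩ - hne
    rw [Function.onFun, disjoint_left]
    intro x hx hx'
    match n, c, n', c' with
    | 0, v, 0, v' =>
      have h : x = v.1 := (D.charMap_zero_ball v).subset hx
      have h' : x = v'.1 := (D.charMap_zero_ball v').subset hx'
      exact hne (congrArg (Sigma.mk 0) (Subtype.ext (h.symm.trans h')))
    | 0, v, 1, i =>
      have h : x = v.1 := (D.charMap_zero_ball v).subset hx
      obtain ⟨t, ht, rfl⟩ := (D.charMap_one_ball i).subset hx'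
      exact D.arc_notMem i t ht (h ▸ v.2)
    | 1, i, 0, v =>
      have h : x = v.1 := (D.charMap_zero_ball v).subset hx'
      obtain ⟨t, ht, rfl⟩ := (D.charMap_one_ball i).subset hx
      exact D.arc_notMem i t ht (h ▸ v.2)
    | 1, i, 1, j =>
      obtain ⟨t, ht, rfl⟩ := (D.charMap_one_ball i).subset hx
      obtain ⟨t', ht', h⟩ := (D.charMap_one_ball j).subset hx'
      exact hne (congrArg (Sigma.mk 1) (D.eq_of_arc_eq i j t ht t' ht' h.symm))
  mapsTo' n c := by
    match n, c with
    | 0, v =>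
      refine ⟨fun _ => ∅, fun f hf => ?_⟩
      rw [Subsingleton.elim f 0, mem_sphere_zero_iff_norm, norm_zero] at hf
      exact absurd hf zero_ne_one
    | 1, i =>
      classical
      let I : (m : ℕ) → Finset (D.Cell m) := fun m => match m with
        | 0 => ({⟨_, D.left_mem i⟩, ⟨_, D.right_mem i⟩} : Finset D.V)
        | _ + 1 => ∅
      refine ⟨I, fun f hf => ?_⟩
      have key : ∀ v : D.V, v ∈ (I 0 : Finset D.V) → D.arc i (f 0) = v →
          D.charMap 1 i f ∈ ⋃ (m < 1) (j ∈ I m), D.charMap m j '' Metric.closedBall 0 1 := by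
        intro v hv h
        refine mem_iUnion₂.2 ⟨0, one_pos, mem_iUnion₂.2 ⟨v, hv, ?_⟩⟩
        exact (D.charMap_zero_closedBall v).superset h
      rcases mem_sphere_fin_one hf with h | h
      · exact key ⟨_, D.left_mem i⟩ (Finset.mem_insert_self _ _) (by rw [h])
      · exact key ⟨_, D.right_mem i⟩ (Finset.mem_insert_of_mem (Finset.mem_singleton_self _)) (by rw [h])
  closed' A _ hA := by
    -- The closed cells are locally finite and cover the space, so a set is closed as soon as its
    -- traces on them are.
    have hU : A = ⋃ p : Σ n, D.Cell n, A ∩ D.charMap p.1 p.2 '' Metric.closedBall 0 1 := by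
      rw [← inter_iUnion, eq_comm, inter_eq_left]
      intro x _
      rcases D.cover x with hx | ⟨i, t, ht, rfl⟩
      · refine mem_iUnion.2 ⟨⟨0, (⟨x, hx⟩ : D.V)⟩, ?_⟩
        exact (D.charMap_zero_closedBall ⟨x, hx⟩).superset rfl
      · refine mem_iUnion.2 ⟨⟨1, i⟩, ?_⟩
        exact (D.charMap_one_closedBall i).superset (mem_image_of_mem _ ht)
    rw [hU]
    exact (D.locallyFinite_cells.subset fun p => inter_subset_right).isClosed_iUnion
      fun p => hA p.1 p.2
  union' := by
    rw [eq_univ_iff_forall]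
    intro x
    rcases D.cover x with hx | ⟨i, t, ht, rfl⟩
    · refine mem_iUnion₂.2 ⟨0, (⟨x, hx⟩ : D.V), ?_⟩
      exact (D.charMap_zero_closedBall ⟨x, hx⟩).superset rfl
    · refine mem_iUnion₂.2 ⟨1, i, ?_⟩
      exact (D.charMap_one_closedBall i).superset (mem_image_of_mem _ ht)

variable [T2Space X]

theorem openCells_zero :
    letI := D.cwComplex
    openCells X 0 = (fun v => {v}) '' D.V := by
  let _ := D.cwComplex
  ext e
  constructor
  · rintro ⟨v, rfl⟩
    exact ⟨Subtype.val (p := (· ∈ D.V)) v, Subtype.property (p := (· ∈ D.V)) v,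
      (D.charMap_zero_ball v).symm⟩
  · rintro ⟨v, hv, rfl⟩
    exact ⟨(⟨v, hv⟩ : D.V), D.charMap_zero_ball ⟨v, hv⟩⟩

theorem openCells_one :
    letI := D.cwComplex
    openCells X 1 = range fun i => D.arc i '' Ioo (-1) 1 := by
  let _ := D.cwComplex
  ext e
  constructor
  · rintro ⟨i, rfl⟩
    exact ⟨i, (D.charMap_one_ball i).symm⟩
  · rintro ⟨i, rfl⟩
    exact ⟨i, D.charMap_one_ball i⟩

theorem openCells_add_two (n : ℕ) :
    letI := D.cwComplex
    openCells X (n + 2) = ∅ := by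
  let _ := D.cwComplex
  ext e
  constructor
  · rintro ⟨i, rfl⟩
    exact PEmpty.elim i
  · exact fun h => h.elim

theorem vertexSet_eq :
    letI := D.cwComplex
    vertexSet X = D.V := by
  let _ := D.cwComplex
  rw [vertexSet, D.openCells_zero]
  ext x
  simp

theorem isGraph [Nonempty D.ι] :
    letI := D.cwComplex
    IsGraph X := by
  let _ := D.cwComplex
  refine ⟨inferInstance, ?_, ?_, D.locallyFinite_cells, ?_⟩
  · rw [D.openCells_one]
    exact range_nonempty _
  · intro n hn
    obtain ⟨k, rfl⟩ := Nat.exists_eq_add_of_lt hn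
    rw [show 1 + k + 1 = k + 2 by ring]
    exact inferInstanceAs (IsEmpty PEmpty)
  · rintro _ ⟨i, rfl⟩
    rw [RelCWComplex.closure_openCell_eq_closedCell]
    have h : RelCWComplex.closedCell 1 i = D.arc i '' Icc (-1) 1 := D.charMap_one_closedBall i
    rw [h]
    have hc : Continuous (Equiv.Set.imageOfInjOn (D.arc i) _ (D.injOn_arc i)) :=
      Continuous.subtype_mk (continuousOn_iff_continuous_domRestrict.1 (D.continuousOn_arc i)) _
    exact ⟨(hc.homeoOfEquivCompactToT2).symm⟩

theorem isInfiniteGraph [Infinite D.ι] :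
    letI := D.cwComplex
    IsInfiniteGraph X := by
  let _ := D.cwComplex
  refine ⟨D.isGraph, fun h => ?_⟩
  have h1 : Finite D.ι := h.toFiniteType.finite_cell 1
  exact not_finite D.ι

/-- Transport of a decomposition along a homeomorphism. -/
def map {Y : Type u} [TopologicalSpace Y] (φ : X ≃ₜ Y) : GraphData Y where
  V := φ '' D.V
  ι := D.ι
  arc i t := φ (D.arc i t)
  continuousOn_arc i := φ.continuous.comp_continuousOn (D.continuousOn_arc i)
  injOn_arc i _ ht _ ht' h := D.injOn_arc i ht ht' (φ.injective h)
  left_mem i := mem_image_of_mem _ (D.left_mem i)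
  right_mem i := mem_image_of_mem _ (D.right_mem i)
  arc_notMem i t ht h := D.arc_notMem i t ht (φ.injective.mem_set_image.1 h)
  eq_of_arc_eq i j t ht t' ht' h := D.eq_of_arc_eq i j t ht t' ht' (φ.injective h)
  cover y := by
    rcases D.cover (φ.symm y) with h | ⟨i, t, ht, h⟩
    · exact Or.inl ⟨_, h, φ.apply_symm_apply y⟩
    · exact Or.inr ⟨i, t, ht, by rw [h, φ.apply_symm_apply]⟩
  locallyFinite_vertex := by
    have h := (D.locallyFinite_vertex.preimage_continuous φ.symm.continuous).comp_injective
      (g := fun v : φ '' D.V => (⟨φ.symm v, by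
        obtain ⟨x, hx, hv⟩ := v.2
        rw [← hv, φ.symm_apply_apply]; exact hx⟩ : D.V))
      (fun v w hvw => Subtype.ext (φ.symm.injective (congrArg Subtype.val hvw)))
    convert h using 2 with v
    ext y
    simp
  locallyFinite_arc := by
    have h := D.locallyFinite_arc.preimage_continuous φ.symm.continuous
    convert h using 2 with i
    rw [← φ.image_eq_preimage_symm, image_image]

theorem graphIsomorphic_map {Y : Type u} [TopologicalSpace Y] [T2Space Y] (φ : X ≃ₜ Y) :
    letI := D.cwComplex
    letI := (D.map φ).cwComplex
    GraphIsomorphic X Y := by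
  let _ := D.cwComplex
  let _ := (D.map φ).cwComplex
  refine ⟨φ, fun n => ?_⟩
  match n with
  | 0 =>
    rw [D.openCells_zero, (D.map φ).openCells_zero, image_image]
    simp only [image_singleton]
    exact (image_image (fun v => ({v} : Set Y)) φ D.V).symm
  | 1 =>
    rw [D.openCells_one, (D.map φ).openCells_one, ← range_comp]
    congr 1
    ext1 i
    exact image_image _ _ _
  | n + 2 => rw [D.openCells_add_two, (D.map φ).openCells_add_two, image_empty]

end GraphData

end GraphData

/-! ### The graph structure of the tree -/

section TreeGraph

open Real

theorem branch_fst_mem_tree (l : ℤ) {s : ℝ} (hs : s ∈ Icc (0 : ℝ) 1) : (s, branch l s) ∈ tree :=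
  ⟨hs, l, rfl⟩

/-- The lower end of the edges of `tree`: each stem `l` is cut into two edges. -/
def edgeLo (i : ℤ × Bool) : ℝ := if i.2 then stemTop (i.1.natAbs + 1) else 0

/-- The upper end of the edges of `tree`. -/
def edgeHi (i : ℤ × Bool) : ℝ := if i.2 then stemTop i.1.natAbs else stemTop (i.1.natAbs + 1)

theorem edgeLo_nonneg (i : ℤ × Bool) : 0 ≤ edgeLo i := by
  unfold edgeLo
  split_ifs
  · exact (stemTop_pos _).le
  · exact le_rfl

theorem edgeHi_le_stemTop (i : ℤ × Bool) : edgeHi i ≤ stemTop i.1.natAbs := by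
  unfold edgeHi
  split_ifs
  · exact le_rfl
  · exact (stemTop_succ_lt _).le

theorem edgeLo_lt_edgeHi (i : ℤ × Bool) : edgeLo i < edgeHi i := by
  unfold edgeLo edgeHi
  split_ifs
  · exact stemTop_succ_lt _
  · exact stemTop_pos _

/-- The affine parametrization of the levels of an edge by `[-1, 1]`. -/
def edgeLevel (i : ℤ × Bool) (r : ℝ) : ℝ := ((1 - r) * edgeLo i + (1 + r) * edgeHi i) / 2

theorem edgeLevel_mem_Icc {i : ℤ × Bool} {r : ℝ} (hr : r ∈ Icc (-1 : ℝ) 1) :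
    edgeLevel i r ∈ Icc (edgeLo i) (edgeHi i) := by
  have := edgeLo_lt_edgeHi i
  unfold edgeLevel
  constructor <;> nlinarith [hr.1, hr.2]

theorem edgeLevel_mem_Ioo {i : ℤ × Bool} {r : ℝ} (hr : r ∈ Ioo (-1 : ℝ) 1) :
    edgeLevel i r ∈ Ioo (edgeLo i) (edgeHi i) := by
  have := edgeLo_lt_edgeHi i
  unfold edgeLevel
  constructor <;> nlinarith [hr.1, hr.2]

theorem exists_edgeLevel_eq {i : ℤ × Bool} {s : ℝ} (hs : s ∈ Icc (edgeLo i) (edgeHi i)) :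
    ∃ r ∈ Icc (-1 : ℝ) 1, edgeLevel i r = s := by
  have h := sub_pos.2 (edgeLo_lt_edgeHi i)
  refine ⟨(2 * s - edgeLo i - edgeHi i) / (edgeHi i - edgeLo i), ⟨?_, ?_⟩, ?_⟩
  · rw [le_div_iff₀ h]; linarith [hs.1]
  · rw [div_le_iff₀ h]; linarith [hs.2]
  · unfold edgeLevel
    field_simp
    ring

theorem edgeLevel_mem_unit {i : ℤ × Bool} {r : ℝ} (hr : r ∈ Icc (-1 : ℝ) 1) :
    edgeLevel i r ∈ Icc (0 : ℝ) 1 :=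
  ⟨(edgeLo_nonneg i).trans (edgeLevel_mem_Icc hr).1,
    (edgeLevel_mem_Icc hr).2.trans ((edgeHi_le_stemTop i).trans (stemTop_le_one _))⟩

/-- The arcs of `tree`, extended to be constant outside the levels in `[0, 1]`. -/
def treeArc (i : ℤ × Bool) (r : ℝ) : tree :=
  ⟨_, branch_fst_mem_tree i.1 (projIcc 0 1 zero_le_one (edgeLevel i r)).2⟩

theorem coe_treeArc {i : ℤ × Bool} {r : ℝ} (hr : r ∈ Icc (-1 : ℝ) 1) :
    (treeArc i r : ℝ × ℝ) = (edgeLevel i r, branch i.1 (edgeLevel i r)) := by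
  have h : (projIcc 0 1 zero_le_one (edgeLevel i r) : ℝ) = edgeLevel i r :=
    congrArg Subtype.val (projIcc_of_mem zero_le_one (edgeLevel_mem_unit hr))
  simp only [treeArc, h]

theorem continuous_treeArc (i : ℤ × Bool) : Continuous (treeArc i) := by
  have h1 : Continuous fun r => (projIcc 0 1 zero_le_one (edgeLevel i r) : ℝ) := by
    refine continuous_subtype_val.comp (continuous_projIcc.comp ?_)
    unfold edgeLevel
    fun_prop
  exact Continuous.subtype_mk (h1.prodMk ((continuous_branch i.1).comp h1)) _

theorem onStem_of_lt {l : ℤ} {s : ℝ} (h : s < stemTop l.natAbs) : OnStem l s := Or.inr h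

/-- The vertices of `tree`: the free ends, the merging points and the top. -/
def treeVertices : Set tree := {p | ∃ l : ℤ, OnStem l p.1.1 ∧ p.1.2 = branch l p.1.1 ∧
  (p.1.1 = 0 ∨ p.1.1 = stemTop (l.natAbs + 1) ∨ p.1.1 = 1)}

theorem mem_treeVertices_of_branch {l : ℤ} {p : tree} (h : p.1.2 = branch l p.1.1)
    (hs : p.1.1 = 0 ∨ p.1.1 = stemTop (l.natAbs + 1)) : p ∈ treeVertices := by
  refine ⟨l, onStem_of_lt ?_, h, hs.imp_right Or.inl⟩
  rcases hs with hs | hs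
  · rw [hs]; exact stemTop_pos _
  · rw [hs]; exact stemTop_succ_lt _

/-- The top of a stem is no longer on that stem when `l ≠ 0`; there it is rewritten as the merging
point on the stem one step closer to `0`. For `l = 0` it is the top of the tree. -/
theorem mem_treeVertices_of_stemTop {l : ℤ} {p : tree} (h : p.1.2 = branch l p.1.1)
    (hs : p.1.1 = stemTop l.natAbs) : p ∈ treeVertices := by
  have key : ∀ n : ℕ, p.1.1 = stemTop (n + 1) → branch (n + 1) p.1.1 = branch n p.1.1 :=
    fun n hn => ((branch_succ_eq_iff n _).2 hn.ge).symm
  rcases Int.natAbs_eq l with hl | hl <;> rcases hn : l.natAbs with _ | n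
  · rw [hn] at hs
    exact ⟨0, Or.inl rfl, by rw [h, hl, hn]; rfl, Or.inr (Or.inr hs)⟩
  · rw [hn] at hs hl
    refine mem_treeVertices_of_branch (l := n) ?_ (Or.inr (by rw [hs]; simp))
    rw [h, hl, ← key n hs]
    push_cast
    rfl
  · rw [hn] at hs
    exact ⟨0, Or.inl rfl, by rw [h, hl, hn]; rfl, Or.inr (Or.inr hs)⟩
  · rw [hn] at hs hl
    refine mem_treeVertices_of_branch (l := -n) ?_ (Or.inr (by rw [hs]; simp))
    rw [h, hl, branch_neg, branch_neg, ← key n hs]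
    push_cast
    rfl

theorem treeArc_neg_one (i : ℤ × Bool) : (treeArc i (-1) : ℝ × ℝ) = (edgeLo i, branch i.1 (edgeLo i)) := by
  have : edgeLevel i (-1) = edgeLo i := by unfold edgeLevel; ring
  rw [coe_treeArc (by simp), this]

theorem treeArc_one (i : ℤ × Bool) : (treeArc i 1 : ℝ × ℝ) = (edgeHi i, branch i.1 (edgeHi i)) := by
  have : edgeLevel i 1 = edgeHi i := by unfold edgeLevel; ring
  rw [coe_treeArc (by simp), this]

theorem treeVertices_subset {p : tree} (hp : p ∈ treeVertices) :
    ∃ i, p = treeArc i (-1) ∨ p = treeArc i 1 := by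
  obtain ⟨l, hl, hb, h | h | h⟩ := hp
  · refine ⟨(l, false), Or.inl (Subtype.ext ?_)⟩
    rw [treeArc_neg_one]
    simp only [edgeLo, Bool.false_eq_true, if_false]
    exact Prod.ext h (by rw [hb, h])
  · refine ⟨(l, false), Or.inr (Subtype.ext ?_)⟩
    rw [treeArc_one]
    simp only [edgeHi, Bool.false_eq_true, if_false]
    exact Prod.ext h (by rw [hb, h])
  · refine ⟨(l, true), Or.inr (Subtype.ext ?_)⟩
    have hl0 : l = 0 := by
      rcases hl with hl | hl
      · exact hl
      · rw [h] at hl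
        exact absurd (stemTop_le_one _) (not_le.2 hl)
    subst hl0
    rw [treeArc_one]
    exact Prod.ext h (by rw [hb, h]; rfl)

theorem treeVertices_left (i : ℤ × Bool) : treeArc i (-1) ∈ treeVertices := by
  have h := treeArc_neg_one i
  refine mem_treeVertices_of_branch (l := i.1) (by rw [h]) ?_
  rw [h]
  unfold edgeLo
  split_ifs
  · exact Or.inr rfl
  · exact Or.inl rfl

theorem treeVertices_right (i : ℤ × Bool) : treeArc i 1 ∈ treeVertices := by
  have h := treeArc_one i
  by_cases hi : i.2
  · refine mem_treeVertices_of_stemTop (l := i.1) (by rw [h]) ?_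
    rw [h]
    simp [edgeHi, hi]
  · refine mem_treeVertices_of_branch (l := i.1) (by rw [h]) (Or.inr ?_)
    rw [h]
    simp [edgeHi, hi]

theorem treeArc_notMem {i : ℤ × Bool} {r : ℝ} (hr : r ∈ Ioo (-1 : ℝ) 1) :
    treeArc i r ∉ treeVertices := by
  rintro ⟨l, hl, hb, hs⟩
  rw [coe_treeArc (Ioo_subset_Icc_self hr)] at hl hb hs
  dsimp only at hl hb hs
  have h := edgeLevel_mem_Ioo (i := i) hr
  have hlt := h.2.trans_le (edgeHi_le_stemTop i)
  have := eq_of_branch_eq hl (onStem_of_lt hlt) hb.symm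
  subst this
  have h1 := stemTop_le_one i.1.natAbs
  rcases hs with hs | hs | hs
  · have := edgeLo_nonneg i
    linarith [h.1]
  · rw [hs] at h
    unfold edgeLo edgeHi at h
    split_ifs at h
    · exact h.1.false
    · exact h.2.false
  · linarith

/-- Interior levels of an edge lie strictly below the top of its stem, where the branch value
determines the stem; the two edges of a stem have disjoint open ranges of levels. -/
theorem eq_of_treeArc_eq {i j : ℤ × Bool} {r r' : ℝ} (hr : r ∈ Ioo (-1 : ℝ) 1)
    (hr' : r' ∈ Ioo (-1 : ℝ) 1) (h : treeArc i r = treeArc j r') : i = j := by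
  have h' := congrArg Subtype.val h
  rw [coe_treeArc (Ioo_subset_Icc_self hr), coe_treeArc (Ioo_subset_Icc_self hr')] at h'
  obtain ⟨h1, h2⟩ := Prod.mk.inj h'
  have hi := edgeLevel_mem_Ioo (i := i) hr
  have hj := edgeLevel_mem_Ioo (i := j) hr'
  rw [← h1] at h2 hj
  have hl := eq_of_branch_eq (onStem_of_lt (hi.2.trans_le (edgeHi_le_stemTop i)))
    (onStem_of_lt (hj.2.trans_le (edgeHi_le_stemTop j))) h2
  refine Prod.ext hl ?_
  unfold edgeLo edgeHi at hi hj
  rw [← hl] at hj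
  rcases hi2 : i.2 with _ | _ <;> rcases hj2 : j.2 with _ | _ <;>
    simp only [hi2, hj2, Bool.false_eq_true, if_false, if_true] at hi hj ⊢
  · linarith [hi.2, hj.1]
  · linarith [hi.1, hj.2]

theorem exists_treeArc_eq (p : tree) : ∃ i, ∃ r ∈ Icc (-1 : ℝ) 1, treeArc i r = p := by
  obtain ⟨hs, l', hl'⟩ := p.2
  obtain ⟨l, hl, hll⟩ := exists_onStem l' p.1.1
  have hle : p.1.1 ≤ stemTop l.natAbs := by
    rcases hl with rfl | hl
    · exact hs.2
    · exact hl.le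
  obtain ⟨b, hb⟩ : ∃ b, p.1.1 ∈ Icc (edgeLo (l, b)) (edgeHi (l, b)) := by
    rcases le_total p.1.1 (stemTop (l.natAbs + 1)) with h | h
    · exact ⟨false, by simpa [edgeLo, edgeHi] using ⟨hs.1, h⟩⟩
    · exact ⟨true, by simpa [edgeLo, edgeHi] using ⟨h, hle⟩⟩
  obtain ⟨r, hr, hrs⟩ := exists_edgeLevel_eq hb
  refine ⟨(l, b), r, hr, Subtype.ext ?_⟩
  rw [coe_treeArc hr, hrs]
  exact Prod.ext rfl (hll.symm.trans hl'.symm)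

theorem exists_nhds_finite_treeArc (p : tree) :
    ∃ U ∈ 𝓝 p, {i | (treeArc i '' Icc (-1) 1 ∩ U).Nonempty}.Finite := by
  -- Solving `(|l| - 1) * π / 12 - 1 < |p.1.2| + 1` for `|l|`, by way of `le_abs_branch`, gives this
  -- threshold.
  obtain ⟨N, hN⟩ := exists_nat_gt (12 * (|p.1.2| + 2) / π + 1)
  refine ⟨{q : tree | |q.1.2| < |p.1.2| + 1}, ?_, ?_⟩
  · refine IsOpen.mem_nhds (isOpen_lt (by fun_prop) continuous_const) ?_
    change |p.1.2| < |p.1.2| + 1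
    linarith
  · refine ((Set.finite_Icc (-(N : ℤ)) N).prod (Set.finite_univ (α := Bool))).subset ?_
    rintro i ⟨_, ⟨r, hr, rfl⟩, hU⟩
    have hU : |(treeArc i r : ℝ × ℝ).2| < |p.1.2| + 1 := hU
    rw [coe_treeArc hr] at hU
    have h := le_abs_branch (l := i.1)
      ((edgeLevel_mem_Icc (i := i) hr).2.trans (edgeHi_le_stemTop i))
    have hπ := pi_pos
    have h2 : (i.1.natAbs : ℝ) < N := by
      refine lt_trans ?_ hN
      rw [← sub_lt_iff_lt_add, lt_div_iff₀ hπ]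
      dsimp only at hU
      linarith
    have h3 : i.1.natAbs < N := by exact_mod_cast h2
    refine ⟨⟨?_, ?_⟩, mem_univ _⟩ <;> omega

/-- The graph structure of `tree`. -/
def treeGraph : GraphData tree where
  V := treeVertices
  ι := ℤ × Bool
  arc := treeArc
  continuousOn_arc i := (continuous_treeArc i).continuousOn
  injOn_arc i r hr r' hr' h := by
    have h' := congrArg (fun q : tree => q.1.1) h
    simp only [coe_treeArc hr, coe_treeArc hr', edgeLevel] at h'
    have hlt := edgeLo_lt_edgeHi i
    have : (r - r') * (edgeHi i - edgeLo i) = 0 := by linarith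
    rcases mul_eq_zero.1 this with h0 | h0 <;> linarith
  left_mem := treeVertices_left
  right_mem := treeVertices_right
  arc_notMem _ _ hr := treeArc_notMem hr
  eq_of_arc_eq _ _ _ hr _ hr' h := eq_of_treeArc_eq hr hr' h
  cover p := Or.inr (exists_treeArc_eq p)
  locallyFinite_vertex p := by
    obtain ⟨U, hU, hf⟩ := exists_nhds_finite_treeArc p
    refine ⟨U, hU, Set.Finite.of_finite_image (f := Subtype.val) ?_ Subtype.val_injective.injOn⟩
    refine ((hf.image fun i => treeArc i (-1)).union (hf.image fun i => treeArc i 1)).subset ?_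
    rintro _ ⟨v, ⟨_, rfl, hvU⟩, rfl⟩
    obtain ⟨i, h | h⟩ := treeVertices_subset v.2
    · refine Or.inl ⟨i, ⟨v, ⟨-1, by simp, h.symm⟩, hvU⟩, h.symm⟩
    · refine Or.inr ⟨i, ⟨v, ⟨1, by simp, h.symm⟩, hvU⟩, h.symm⟩
  locallyFinite_arc := exists_nhds_finite_treeArc

instance : Infinite treeGraph.ι := inferInstanceAs (Infinite (ℤ × Bool))

end TreeGraph

/-! ### The hypersurface: regularity and critical points -/

section ZeroSet

variable {n : ℕ}

/-- The point with coordinates `(x₁, x₂, y₁, …, yₙ)`. -/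
def mkPoint (s t : ℝ) (y : Fin n → ℝ) : EuclideanSpace ℝ (Fin (n + 2)) :=
  WithLp.toLp 2 (Fin.cons s (Fin.cons t y))

@[simp] theorem mkPoint_zero (s t : ℝ) (y : Fin n → ℝ) : mkPoint s t y 0 = s := rfl

@[simp] theorem mkPoint_one (s t : ℝ) (y : Fin n → ℝ) : mkPoint s t y 1 = t := rfl

@[simp] theorem mkPoint_succ_succ (s t : ℝ) (y : Fin n → ℝ) (i : Fin n) :
    mkPoint s t y i.succ.succ = y i := rfl

theorem euclideanSpace_ext {x x' : EuclideanSpace ℝ (Fin (n + 2))} (h0 : x 0 = x' 0)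
    (h1 : x 1 = x' 1) (h2 : ∀ i : Fin n, x i.succ.succ = x' i.succ.succ) : x = x' := by
  ext j
  refine Fin.cases h0 (fun j => Fin.cases h1 h2 j) j

theorem definingFun_eq (x : EuclideanSpace ℝ (Fin (n + 2))) :
    definingFun (n + 1) x = slice (x 0) (x 1) - ∑ i : Fin n, x i.succ.succ ^ 2 := by
  have : ∑ j : Fin (n + 1 + 1) with 2 ≤ j.val, x j ^ 2 = ∑ i : Fin n, x i.succ.succ ^ 2 := by
    rw [Finset.sum_filter, Fin.sum_univ_succ, Fin.sum_univ_succ]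
    simp
  unfold definingFun
  rw [this]
  rfl

theorem mem_zeroSet_iff (x : EuclideanSpace ℝ (Fin (n + 2))) :
    x ∈ zeroSet (n + 1) ↔ ∑ i : Fin n, x i.succ.succ ^ 2 = slice (x 0) (x 1) := by
  change definingFun (n + 1) x = 0 ↔ _
  rw [definingFun_eq, sub_eq_zero, eq_comm]

theorem mem_region_of_mem_zeroSet {x : EuclideanSpace ℝ (Fin (n + 2))} (hx : x ∈ zeroSet (n + 1)) :
    (x 0, x 1) ∈ region := by
  rw [← slice_nonneg_iff, ← (mem_zeroSet_iff x).1 hx]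
  positivity

theorem slice_eq_zero_of_forall {x : EuclideanSpace ℝ (Fin (n + 2))} (hx : x ∈ zeroSet (n + 1))
    (h : ∀ i : Fin n, x i.succ.succ = 0) : slice (x 0) (x 1) = 0 := by
  rw [← (mem_zeroSet_iff x).1 hx]
  simp [h]

theorem analyticOnNhd_definingFun (m : ℕ) : AnalyticOnNhd ℝ (definingFun m) univ := by
  intro x _
  have hc : ∀ i, AnalyticAt ℝ (fun x : EuclideanSpace ℝ (Fin (m + 1)) => x i) x := fun i =>
    (EuclideanSpace.proj i : EuclideanSpace ℝ (Fin (m + 1)) →L[ℝ] ℝ).analyticAt x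
  have hq : AnalyticAt ℝ (fun x : EuclideanSpace ℝ (Fin (m + 1)) => x 1 ^ 2 + 1) x :=
    ((hc 1).pow 2).add analyticAt_const
  have hpos : x 1 ^ 2 + 1 ≠ 0 := by positivity
  have hs : AnalyticAt ℝ (fun x : EuclideanSpace ℝ (Fin (m + 1)) => Real.sin (x 1) ^ 2) x :=
    ((Real.analyticAt_sin).comp (hc 1)).pow 2
  refine AnalyticAt.sub (AnalyticAt.mul ((hc 0).sub (hs.div (analyticAt_const.mul hq)
    (mul_ne_zero two_ne_zero hpos))) ((analyticAt_const.div hq hpos).sub (hc 0))) ?_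
  exact Finset.analyticAt_fun_sum _ fun i _ => (hc i).pow 2

theorem contDiff_definingFun (m : ℕ) : ContDiff ℝ ∞ (definingFun m) :=
  (analyticOnNhd_definingFun m).contDiff

theorem hasDerivAt_slice_line (s t a b : ℝ) :
    HasDerivAt (fun u : ℝ => slice (s + u * a) (t + u * b))
      ((a - deriv lower t * b) * (upper t - s) + (s - lower t) * (deriv upper t * b - a)) 0 := by
  have hs : HasDerivAt (fun u : ℝ => s + u * a) a 0 := by
    simpa using ((hasDerivAt_id (0 : ℝ)).mul_const a).const_add s
  have ht : HasDerivAt (fun u : ℝ => t + u * b) b 0 := by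
    simpa using ((hasDerivAt_id (0 : ℝ)).mul_const b).const_add t
  have hl : HasDerivAt lower (deriv lower t) (t + 0 * b) := by
    rw [zero_mul, add_zero]
    exact (hasDerivAt_lower t).differentiableAt.hasDerivAt
  have hu : HasDerivAt upper (deriv upper t) (t + 0 * b) := by
    rw [zero_mul, add_zero]
    exact (hasDerivAt_upper t).differentiableAt.hasDerivAt
  have h := (hs.sub (hl.comp (0 : ℝ) ht)).mul ((hu.comp (0 : ℝ) ht).sub hs)
  refine h.congr_deriv ?_
  simp

theorem fderiv_definingFun (x v : EuclideanSpace ℝ (Fin (n + 2))) :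
    fderiv ℝ (definingFun (n + 1)) x v =
      (v 0 - deriv lower (x 1) * v 1) * (upper (x 1) - x 0) +
        (x 0 - lower (x 1)) * (deriv upper (x 1) * v 1 - v 0) -
        ∑ i : Fin n, 2 * x i.succ.succ * v i.succ.succ := by
  have hd : HasFDerivAt (definingFun (n + 1)) (fderiv ℝ (definingFun (n + 1)) x) x :=
    ((contDiff_definingFun (n + 1)).differentiable (by simp) x).hasFDerivAt
  have hline : HasDerivAt (fun u : ℝ => x + u • v) v 0 := by
    simpa using ((hasDerivAt_id (0 : ℝ)).smul_const v).const_add x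
  have h1 : HasDerivAt (fun u : ℝ => definingFun (n + 1) (x + u • v))
      (fderiv ℝ (definingFun (n + 1)) x v) 0 := by
    have hd' : HasFDerivAt (definingFun (n + 1)) (fderiv ℝ (definingFun (n + 1)) x)
        (x + (0 : ℝ) • v) := by rwa [zero_smul, add_zero]
    exact hd'.comp_hasDerivAt (0 : ℝ) hline
  have h2 : HasDerivAt (fun u : ℝ => ∑ i : Fin n, (x i.succ.succ + u * v i.succ.succ) ^ 2)
      (∑ i : Fin n, 2 * x i.succ.succ * v i.succ.succ) 0 := by
    refine HasDerivAt.fun_sum fun i _ => ?_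
    have := (((hasDerivAt_id (0 : ℝ)).mul_const (v i.succ.succ)).const_add (x i.succ.succ)).pow 2
    refine this.congr_deriv ?_
    simp
  have h3 := (hasDerivAt_slice_line (x 0) (x 1) (v 0) (v 1)).sub h2
  refine h1.unique (h3.congr_of_eventuallyEq (Filter.Eventually.of_forall fun u => ?_))
  simp only [definingFun_eq]
  rfl

theorem fderiv_definingFun_mkPoint (x : EuclideanSpace ℝ (Fin (n + 2))) (a b : ℝ)
    (y : Fin n → ℝ) :
    fderiv ℝ (definingFun (n + 1)) x (mkPoint a b y) =
      (a - deriv lower (x 1) * b) * (upper (x 1) - x 0) +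
        (x 0 - lower (x 1)) * (deriv upper (x 1) * b - a) -
        ∑ i : Fin n, 2 * x i.succ.succ * y i := by
  rw [fderiv_definingFun]
  rfl

theorem sub_ne_zero_of_slice_eq_zero {s t : ℝ} (h : slice s t = 0) :
    (upper t - s) - (s - lower t) ≠ 0 := by
  have := lower_lt_upper t
  rcases mul_eq_zero.1 h with h | h <;> intro h' <;> linarith

/-- If the differential vanished, the `y`-derivatives would give `y = 0`, placing the point over one
of the two boundary curves. There the `x₁`-derivative `(upper - s) - (s - lower)` is nonzero, as the
curves never meet. -/
theorem isRegularZero_definingFun (n : ℕ) :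
    IsRegularZero (EuclideanSpace ℝ (Fin (n + 1))) (definingFun (n + 1)) where
  finrank_add_one := by simp
  contDiff := contDiff_definingFun _
  fderiv_ne_zero x hx h := by
    have hy : ∀ i : Fin n, x i.succ.succ = 0 := by
      intro i
      have := fderiv_definingFun_mkPoint x 0 0 (Pi.single i 1)
      rw [h] at this
      simpa [Pi.single_apply] using this
    have h0 := slice_eq_zero_of_forall hx hy
    have := fderiv_definingFun_mkPoint x 1 0 0
    rw [h] at this
    apply sub_ne_zero_of_slice_eq_zero h0
    simp at this
    linarith

/-- The manifold structure on the hypersurface. -/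
@[reducible]
def zeroSetChartedSpace (n : ℕ) :
    ChartedSpace (EuclideanSpace ℝ (Fin (n + 1))) (zeroSet (n + 1)) :=
  (isRegularZero_definingFun n).chartedSpace

theorem isManifold_zeroSet (n : ℕ) :
    letI := zeroSetChartedSpace n
    IsManifold (𝓡 (n + 1)) ∞ (zeroSet (n + 1)) :=
  (isRegularZero_definingFun n).isManifold

theorem isSmoothEmbedding_zeroSet_val (n : ℕ) :
    letI := zeroSetChartedSpace n
    IsSmoothEmbedding (𝓡 (n + 1)) 𝓘(ℝ, EuclideanSpace ℝ (Fin (n + 2))) ∞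
      (Subtype.val : zeroSet (n + 1) → EuclideanSpace ℝ (Fin (n + 2))) :=
  (isRegularZero_definingFun n).isSmoothEmbedding_val

theorem contDiff_coord (j : Fin (n + 2)) :
    ContDiff ℝ ∞ fun x : EuclideanSpace ℝ (Fin (n + 2)) => x j :=
  (EuclideanSpace.proj j : EuclideanSpace ℝ (Fin (n + 2)) →L[ℝ] ℝ).contDiff

theorem contMDiff_firstCoord (n : ℕ) :
    letI := zeroSetChartedSpace n
    ContMDiff (𝓡 (n + 1)) 𝓘(ℝ, ℝ) ∞ (firstCoord (n + 1)) := by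
  let _ := zeroSetChartedSpace n
  exact (contDiff_coord 0).contMDiff.comp (isSmoothEmbedding_zeroSet_val n).contMDiff

/-- Criticality means that every tangent vector has zero first coordinate. With `α` and `β` the
first two partial derivatives of the defining function, suitable tangent vectors isolate each
condition. -/
theorem mem_criticalPoints_iff (x : zeroSet (n + 1)) :
    letI := zeroSetChartedSpace n
    x ∈ criticalPoints (m := n + 1) (firstCoord (n + 1)) ↔
      (∀ i : Fin n, x.1 i.succ.succ = 0) ∧
        (x.1 0 - lower (x.1 1)) * deriv upper (x.1 1) -
          deriv lower (x.1 1) * (upper (x.1 1) - x.1 0) = 0 := by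
  let _ := zeroSetChartedSpace n
  have h := (isRegularZero_definingFun n).mfderiv_comp_val_eq_zero_iff (contDiff_coord 0) x
  have hG : ∀ v, fderiv ℝ (fun x : EuclideanSpace ℝ (Fin (n + 2)) => x 0) x.1 v = v 0 := fun v => by
    have := (EuclideanSpace.proj 0 : EuclideanSpace ℝ (Fin (n + 2)) →L[ℝ] ℝ).hasFDerivAt (x := x.1)
    exact congrArg (fun L : EuclideanSpace ℝ (Fin (n + 2)) →L[ℝ] ℝ => L v) this.fderiv
  simp only [hG] at h
  refine Iff.trans h ⟨fun hx => ?_, ?_⟩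
  · set α := (upper (x.1 1) - x.1 0) - (x.1 0 - lower (x.1 1)) with hα
    set β := (x.1 0 - lower (x.1 1)) * deriv upper (x.1 1) -
      deriv lower (x.1 1) * (upper (x.1 1) - x.1 0) with hβ
    constructor
    · intro i
      -- This vector and `(β, -α, 0)` below are tangent by cancellation; their first coordinates are
      -- `2 * y_i` and `β`.
      have := hx (mkPoint (2 * x.1 i.succ.succ) 0 (Pi.single i α)) (by
        rw [fderiv_definingFun_mkPoint]
        simp [Pi.single_apply, hα]
        ring)
      simpa using this
    · exact hx (mkPoint β (-α) 0) (by
        rw [fderiv_definingFun_mkPoint]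
        simp only [Pi.zero_apply, mul_zero, Finset.sum_const_zero, hα, hβ]
        ring)
  · rintro ⟨hy, hβ⟩ v hv
    rw [fderiv_definingFun] at hv
    simp only [hy, mul_zero, zero_mul, Finset.sum_const_zero] at hv
    have hα := sub_ne_zero_of_slice_eq_zero (slice_eq_zero_of_forall x.2 hy)
    have : ((upper (x.1 1) - x.1 0) - (x.1 0 - lower (x.1 1))) * v 0 = 0 := by
      linear_combination hv - v 1 * hβ
    exact (mul_eq_zero.1 this).resolve_left hα

end ZeroSet

/-! ### Sections over the region; connectedness and non-compactness -/

section Sections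

variable {n : ℕ}

/-- The section of the projection of `zeroSet` to `region` in the direction `w`. -/
def sectionAt (w : Fin n → ℝ) (p : ℝ × ℝ) : EuclideanSpace ℝ (Fin (n + 2)) :=
  mkPoint p.1 p.2 fun i => √(slice p.1 p.2) * w i

theorem continuous_mkPoint {X : Type*} [TopologicalSpace X] {f g : X → ℝ} {y : X → Fin n → ℝ}
    (hf : Continuous f) (hg : Continuous g) (hy : Continuous y) :
    Continuous fun x => mkPoint (f x) (g x) (y x) := by
  refine (PiLp.continuous_toLp 2 _).comp ?_
  refine continuous_pi fun j => ?_
  refine Fin.cases hf (fun j => Fin.cases hg (fun i => ?_) j) j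
  exact (continuous_apply i).comp hy

theorem continuous_sectionAt (w : Fin n → ℝ) : Continuous (sectionAt w) := by
  have := continuous_slice
  exact continuous_mkPoint continuous_fst continuous_snd (by fun_prop)

theorem sectionAt_mem {w : Fin n → ℝ} (hw : ∑ i, w i ^ 2 = 1) {p : ℝ × ℝ} (hp : p ∈ region) :
    sectionAt w p ∈ zeroSet (n + 1) := by
  rw [mem_zeroSet_iff]
  simp only [sectionAt, mkPoint_zero, mkPoint_one, mkPoint_succ_succ, mul_pow, ← Finset.mul_sum,
    hw, Real.sq_sqrt (slice_nonneg_iff.2 hp), mul_one]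

theorem sectionAt_of_slice_eq_zero (w : Fin n → ℝ) {p : ℝ × ℝ} (hp : slice p.1 p.2 = 0) :
    sectionAt w p = mkPoint p.1 p.2 0 := by
  unfold sectionAt
  rw [hp]
  congr 1
  ext i
  simp

theorem mkPoint_mem_zeroSet {s t : ℝ} (h : slice s t = 0) :
    (mkPoint s t 0 : EuclideanSpace ℝ (Fin (n + 2))) ∈ zeroSet (n + 1) := by
  rw [mem_zeroSet_iff]
  simp [h]

theorem exists_eq_sectionAt (hn : 0 < n) {x : EuclideanSpace ℝ (Fin (n + 2))}
    (hx : x ∈ zeroSet (n + 1)) :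
    ∃ w : Fin n → ℝ, ∑ i, w i ^ 2 = 1 ∧ x = sectionAt w (x 0, x 1) := by
  have hsum := (mem_zeroSet_iff x).1 hx
  have h0 : 0 ≤ slice (x 0) (x 1) := by rw [← hsum]; positivity
  rcases h0.eq_or_lt with h | h
  · refine ⟨Pi.single ⟨0, hn⟩ 1, by simp [Pi.single_apply], ?_⟩
    rw [sectionAt_of_slice_eq_zero _ h.symm]
    refine euclideanSpace_ext rfl rfl fun i => ?_
    rw [← h, Finset.sum_eq_zero_iff_of_nonneg fun _ _ => sq_nonneg _] at hsum
    simpa using hsum i (Finset.mem_univ i)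
  · have hr := Real.sqrt_pos.2 h
    refine ⟨fun i => x i.succ.succ / √(slice (x 0) (x 1)), ?_, ?_⟩
    · simp only [div_pow, Real.sq_sqrt h0, ← Finset.sum_div, hsum]
      exact div_self h.ne'
    · refine euclideanSpace_ext rfl rfl fun i => ?_
      simp only [sectionAt, mkPoint_succ_succ]
      field_simp

theorem isPreconnected_region : IsPreconnected region := by
  have h : region = (fun q : ℝ × ℝ => (lower q.1 + q.2 * (upper q.1 - lower q.1), q.1)) ''
      (univ ×ˢ Icc 0 1) := by
    ext ⟨s, t⟩
    have hlt := sub_pos.2 (lower_lt_upper t)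
    constructor
    · rintro ⟨h1, h2⟩
      dsimp only at h1 h2
      refine ⟨(t, (s - lower t) / (upper t - lower t)), ⟨mem_univ _, ?_, ?_⟩, ?_⟩
      · exact div_nonneg (by linarith) hlt.le
      · rw [div_le_one hlt]
        linarith
      · refine Prod.ext ?_ rfl
        simp only
        field_simp
        ring
    · rintro ⟨⟨t', r⟩, ⟨-, hr⟩, h⟩
      obtain ⟨rfl, rfl⟩ := Prod.mk.inj h
      dsimp only at hr hlt
      constructor <;> dsimp only <;> nlinarith [hr.1, hr.2]
  rw [h]
  have h1 := continuous_lower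
  have h2 := continuous_upper
  exact (isPreconnected_univ.prod isPreconnected_Icc).image _ (Continuous.continuousOn (by fun_prop))

theorem slice_one_zero : slice 1 0 = 0 := by simp [slice, lower, upper]

/-- The hypersurface is the union of the images of `region` under the sections in all unit
directions; each is connected and contains the point over `(1, 0)`, where the sphere is collapsed.
-/
theorem isConnected_zeroSet (hn : 0 < n) : IsConnected (zeroSet (n + 1)) := by
  have hx₀ : (mkPoint 1 0 0 : EuclideanSpace ℝ (Fin (n + 2))) ∈ zeroSet (n + 1) :=
    mkPoint_mem_zeroSet slice_one_zero
  refine ⟨⟨_, hx₀⟩, isPreconnected_of_forall (mkPoint 1 0 0) fun x hx => ?_⟩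
  obtain ⟨w, hw, hxw⟩ := exists_eq_sectionAt hn hx
  refine ⟨sectionAt w '' region, image_subset_iff.2 fun p hp => sectionAt_mem hw hp, ?_, ?_,
    isPreconnected_region.image _ (continuous_sectionAt w).continuousOn⟩
  · refine ⟨(1, 0), slice_nonneg_iff.1 slice_one_zero.ge, ?_⟩
    exact sectionAt_of_slice_eq_zero w slice_one_zero
  · exact ⟨_, mem_region_of_mem_zeroSet hx, hxw.symm⟩

theorem not_isCompact_zeroSet : ¬ IsCompact (zeroSet (n + 1)) := by
  intro h
  obtain ⟨B, hB⟩ := (h.image (f := fun x : EuclideanSpace ℝ (Fin (n + 2)) => x 1)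
    (contDiff_coord 1).continuous).bddAbove
  obtain ⟨k, hk⟩ := exists_nat_gt (B / Real.pi)
  rw [div_lt_iff₀ Real.pi_pos] at hk
  -- The zeros of `lower` at the multiples of `π` give an unbounded sequence of points at level `0`.
  have hs : slice 0 (k * Real.pi) = 0 := by simp [slice, lower_nat_mul_pi]
  have := hB ⟨_, mkPoint_mem_zeroSet hs, rfl⟩
  simp only [mkPoint_one] at this
  linarith

end Sections

/-! ### Contours as fibres of the map to the tree -/

section Contours

variable {n : ℕ}

/-- The map to the plane whose fibres are the contours. -/
def toTree (x : zeroSet (n + 1)) : tree :=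
  ⟨(x.1 0, label (x.1 0) (x.1 1)), image_region.subset ⟨_, mem_region_of_mem_zeroSet x.2, rfl⟩⟩

theorem continuous_coord (j : Fin (n + 2)) : Continuous fun x : zeroSet (n + 1) => x.1 j :=
  (contDiff_coord j).continuous.comp continuous_subtype_val

theorem continuous_toTree : Continuous (toTree (n := n)) :=
  Continuous.subtype_mk ((continuous_coord 0).prodMk
    (continuous_label.comp ((continuous_coord 0).prodMk (continuous_coord 1)))) _

theorem surjective_toTree (hn : 0 < n) : Function.Surjective (toTree (n := n)) := by
  rintro ⟨p, hp⟩
  obtain ⟨q, hq, rfl⟩ := image_region.superset hp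
  have hw : ∑ i, (Pi.single ⟨0, hn⟩ 1 : Fin n → ℝ) i ^ 2 = 1 := by simp [Pi.single_apply]
  exact ⟨⟨sectionAt _ q, sectionAt_mem hw hq⟩, rfl⟩

theorem toTree_eq_iff {x y : zeroSet (n + 1)} :
    toTree x = toTree y ↔ x.1 0 = y.1 0 ∧ label (x.1 0) (x.1 1) = label (y.1 0) (y.1 1) := by
  rw [toTree, toTree, Subtype.mk.injEq, Prod.mk.injEq]

/-- A contour projects to an interval of `x₂` on which `lower` stays below the level, so `label` is
constant on it. Conversely a fibre lies over an interval `[a, b]` and is the union of the sections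
over it, all passing through the collapsed point over `a`. -/
theorem mem_contour_iff (hn : 0 < n) {x y : zeroSet (n + 1)} :
    y ∈ contour (firstCoord (n + 1)) x ↔ toTree y = toTree x := by
  have hxr := mem_region_of_mem_zeroSet x.2
  constructor
  · intro hy
    have hC := isPreconnected_connectedComponentIn (x := x)
      (F := firstCoord (n + 1) ⁻¹' {firstCoord (n + 1) x})
    have hsub := connectedComponentIn_subset (firstCoord (n + 1) ⁻¹' {firstCoord (n + 1) x}) x
    have h0 : ∀ z ∈ contour (firstCoord (n + 1)) x, z.1 0 = x.1 0 := fun z hz => hsub hz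
    have hord := (hC.image (fun z => z.1 1) (continuous_coord 1).continuousOn).ordConnected
    have hlow : ∀ a ∈ contour (firstCoord (n + 1)) x, ∀ b ∈ contour (firstCoord (n + 1)) x,
        a.1 1 ≤ b.1 1 → label (x.1 0) (a.1 1) = label (x.1 0) (b.1 1) := by
      intro a ha b hb hab
      refine label_eq_of_Icc_subset hab fun t ht => ?_
      obtain ⟨z, hz, rfl⟩ := hord.out (mem_image_of_mem _ ha) (mem_image_of_mem _ hb) ht
      rw [← h0 z hz]
      exact (mem_region_of_mem_zeroSet z.2).1
    rw [toTree_eq_iff, h0 y hy]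
    refine ⟨rfl, ?_⟩
    have hxx := mem_contour_self (firstCoord (n + 1)) x
    rcases le_total (y.1 1) (x.1 1) with h | h
    · exact hlow y hy x hxx h
    · exact (hlow x hxx y hy h).symm
  · intro hy
    rw [toTree_eq_iff] at hy
    obtain ⟨a, b, hab, hI, ha, -⟩ := exists_fiber_eq_Icc hxr
    let Z : Set (zeroSet (n + 1)) := {z | z.1 0 = x.1 0 ∧ z.1 1 ∈ Icc a b}
    have hZ : IsPreconnected Z := by
      refine isPreconnected_of_forall ⟨mkPoint (x.1 0) a 0, mkPoint_mem_zeroSet ha⟩ fun z hz => ?_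
      obtain ⟨w, hw, hzw⟩ := exists_eq_sectionAt hn z.2
      have himage : Subtype.val '' ((Subtype.val : zeroSet (n + 1) → _) ⁻¹'
          (sectionAt w '' ((fun t => (x.1 0, t)) '' Icc a b))) =
          sectionAt w '' ((fun t => (x.1 0, t)) '' Icc a b) := by
        rw [Subtype.image_preimage_coe, inter_eq_right]
        rintro _ ⟨_, ⟨t, ht, rfl⟩, rfl⟩
        exact sectionAt_mem hw ((hI t).1 ht).1
      refine ⟨Subtype.val ⁻¹' (sectionAt w '' ((fun t => (x.1 0, t)) '' Icc a b)), ?_, ?_, ?_, ?_⟩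
      · rintro z' ⟨_, ⟨t, ht, rfl⟩, h⟩
        constructor
        · rw [← h]; rfl
        · rw [← h]; exact ht
      · exact ⟨_, ⟨a, left_mem_Icc.2 hab, rfl⟩, sectionAt_of_slice_eq_zero w ha⟩
      · refine ⟨_, ⟨z.1 1, hz.2, rfl⟩, ?_⟩
        dsimp only
        rw [← hz.1]
        exact hzw.symm
      · rw [← IsEmbedding.subtypeVal.isInducing.isPreconnected_image, himage]
        exact (isPreconnected_Icc.image _ (by fun_prop)).image _
          (continuous_sectionAt w).continuousOn
    have hxZ : x ∈ Z := ⟨rfl, (hI _).2 ⟨hxr, rfl⟩⟩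
    have hyZ : y ∈ Z := by
      refine ⟨hy.1, (hI _).2 ⟨?_, ?_⟩⟩
      · rw [← hy.1]; exact mem_region_of_mem_zeroSet y.2
      · rw [← hy.2, hy.1]
    exact hZ.subset_connectedComponentIn hxZ (fun z hz => hz.1) hyZ

theorem isCompact_preimage_toTree {T : Set tree} (hT : IsCompact T) :
    IsCompact (toTree (n := n) ⁻¹' T) := by
  rw [IsEmbedding.subtypeVal.isCompact_iff]
  have hcl : IsClosed (zeroSet (n + 1)) :=
    isClosed_eq (contDiff_definingFun (n + 1)).continuous continuous_const
  obtain ⟨C, hC⟩ := (hT.image (f := fun q : tree => |q.1.2|) (by fun_prop)).bddAbove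
  refine Metric.isCompact_of_isClosed_isBounded ?_ ?_
  · exact hcl.isClosedEmbedding_subtypeVal.isClosedMap _ (hT.isClosed.preimage continuous_toTree)
  · rw [isBounded_iff_forall_norm_le]
    -- The three summands bound `x₁ ^ 2`, `x₂ ^ 2` and `∑ y_j ^ 2 = slice ≤ 1`.
    refine ⟨√(1 + (12 * (C + 1)) ^ 2 + 1), ?_⟩
    rintro _ ⟨x, hx, rfl⟩
    have hr := mem_region_of_mem_zeroSet x.2
    have h01 := region_fst_mem hr
    have hlab : |label (x.1 0) (x.1 1)| ≤ C := hC ⟨_, hx, rfl⟩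
    have ht := abs_le_of_abs_label_le hr hlab
    rw [EuclideanSpace.norm_eq]
    refine Real.sqrt_le_sqrt ?_
    rw [Fin.sum_univ_succ, Fin.sum_univ_succ]
    simp only [Real.norm_eq_abs, sq_abs]
    have hs : slice (x.1 0) (x.1 1) ≤ 1 := by
      have h1 := upper_le_one (x.1 1)
      have h2 := lower_nonneg (x.1 1)
      have h3 := hr.1
      have h4 := hr.2
      dsimp only at h01 h3 h4
      unfold slice
      nlinarith [h01.1, h01.2]
    have hsum := (mem_zeroSet_iff x.1).1 x.2
    have h1 : (x.1 0) ^ 2 ≤ 1 := by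
      dsimp only at h01
      nlinarith [h01.1, h01.2]
    have h2 : (x.1 1) ^ 2 ≤ (12 * (C + 1)) ^ 2 := by
      rw [← sq_abs]
      exact pow_le_pow_left₀ (abs_nonneg _) ht 2
    have h3 : x.1 (Fin.succ 0) = x.1 1 := rfl
    rw [h3]
    linarith

theorem isClosedMap_toTree : IsClosedMap (toTree (n := n)) :=
  (isProperMap_iff_isCompact_preimage.2
    ⟨continuous_toTree, fun _ hT => isCompact_preimage_toTree hT⟩).isClosedMap

/-- The Reeb space of the first coordinate is homeomorphic to `tree`. -/
def reebHomeomorph (hn : 0 < n) : tree ≃ₜ ReebSpace (firstCoord (n + 1)) := by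
  have hc : Continuous (Quotient.lift (s := contourSetoid (firstCoord (n + 1))) toTree
      fun x y h => ((mem_contour_iff hn).1 h).symm) := continuous_toTree.quotient_lift _
  refine (Equiv.toHomeomorphOfContinuousClosed (Equiv.ofBijective _ ⟨?_, ?_⟩) hc ?_).symm
  · rintro ⟨x⟩ ⟨y⟩ h
    exact Quotient.sound ((mem_contour_iff hn).2 h.symm)
  · intro p
    obtain ⟨x, hx⟩ := surjective_toTree hn p
    exact ⟨Quotient.mk _ x, hx⟩
  · intro S hS
    have h : Quotient.lift (s := contourSetoid (firstCoord (n + 1))) toTree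
        (fun x y h => ((mem_contour_iff hn).1 h).symm) '' S =
        toTree '' (quotientMap (firstCoord (n + 1)) ⁻¹' S) := by
      ext p
      constructor
      · rintro ⟨⟨x⟩, hx, rfl⟩
        exact ⟨x, hx, rfl⟩
      · rintro ⟨x, hx, rfl⟩
        exact ⟨_, hx, rfl⟩
    -- The induced bijection is closed because `toTree`, being proper, is closed.
    exact h ▸ isClosedMap_toTree _ (hS.preimage continuous_quotient_mk')

theorem reebHomeomorph_symm_quotientMap (hn : 0 < n) (x : zeroSet (n + 1)) :
    (reebHomeomorph hn).symm (quotientMap (firstCoord (n + 1)) x) = toTree x := rfl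

theorem reebHomeomorph_toTree (hn : 0 < n) (x : zeroSet (n + 1)) :
    reebHomeomorph hn (toTree x) = quotientMap (firstCoord (n + 1)) x := by
  rw [← reebHomeomorph_symm_quotientMap hn, Homeomorph.apply_symm_apply]

theorem isCompact_preimage_quotientMap (hn : 0 < n) {T : Set (ReebSpace (firstCoord (n + 1)))}
    (hT : IsCompact T) : IsCompact (quotientMap (firstCoord (n + 1)) ⁻¹' T) := by
  have h : quotientMap (firstCoord (n + 1)) ⁻¹' T =
      toTree ⁻¹' ((reebHomeomorph hn).symm '' T) := by
    ext x
    rw [mem_preimage, mem_preimage, ← reebHomeomorph_symm_quotientMap hn,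
      (reebHomeomorph hn).symm.injective.mem_set_image]
  rw [h]
  exact isCompact_preimage_toTree (hT.image (reebHomeomorph hn).symm.continuous)

end Contours

/-! ### Critical contours are the vertices of the tree -/

section CriticalContours

variable {n : ℕ}

theorem deriv_lower_neg (t : ℝ) : deriv lower (-t) = -deriv lower t := by
  have h := deriv_comp_neg lower t
  have h2 : (fun x => lower (-x)) = lower := funext lower_neg
  rw [h2] at h
  rw [h, neg_neg]

theorem label_peak (k : ℕ) : label (lower (peak k)) (peak k) = branch k (lower (peak k)) := by
  have h := peak_mem k
  unfold branch
  push_cast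
  exact ((label_eq_iff h.1).2 fun x hx => lower_le_lower_peak ⟨hx.1, hx.2.trans h.2.le⟩).symm

/-- A critical point lies over a boundary curve. On the lower curve it sits at a critical point of
`lower`, a multiple of `π` or a peak up to sign; on the upper curve only at `(1, 0)`. -/
theorem toTree_mem_treeVertices {x : zeroSet (n + 1)} (hy : ∀ i : Fin n, x.1 i.succ.succ = 0)
    (hβ : (x.1 0 - lower (x.1 1)) * deriv upper (x.1 1) -
          deriv lower (x.1 1) * (upper (x.1 1) - x.1 0) = 0) : toTree x ∈ treeVertices := by
  have hlt := lower_lt_upper (x.1 1)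
  rcases mul_eq_zero.1 (slice_eq_zero_of_forall x.2 hy) with h | h
  · have hs : x.1 0 = lower (x.1 1) := by linarith
    have hd : deriv lower (x.1 1) = 0 := by
      rw [h, zero_mul, zero_sub, neg_eq_zero] at hβ
      exact (mul_eq_zero.1 hβ).resolve_right (by linarith)
    have key : ∀ t, 0 ≤ t → deriv lower t = 0 → ∃ k : ℕ, label (lower t) t = branch k (lower t) ∧
        (lower t = 0 ∨ lower t = stemTop (k + 1)) := by
      intro t ht hdt
      obtain ⟨k, rfl | rfl⟩ := eq_of_deriv_lower_eq_zero ht hdt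
      · exact ⟨k, rfl, Or.inl (lower_nat_mul_pi k)⟩
      · exact ⟨k, label_peak k, Or.inr rfl⟩
    rcases le_total 0 (x.1 1) with h0 | h0
    · obtain ⟨k, hk, hk'⟩ := key _ h0 hd
      rw [← hs] at hk hk'
      exact mem_treeVertices_of_branch (l := k) hk hk'
    · obtain ⟨k, hk, hk'⟩ := key (-(x.1 1)) (by linarith) (by rw [deriv_lower_neg, hd, neg_zero])
      rw [lower_neg, ← hs] at hk hk'
      refine mem_treeVertices_of_branch (l := -k) ?_ (by rwa [Int.natAbs_neg])
      rw [branch_neg]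
      change label (x.1 0) (x.1 1) = -branch k (x.1 0)
      rw [← hk, label_neg, neg_neg]
  · have hs : x.1 0 = upper (x.1 1) := by linarith
    have hd : deriv upper (x.1 1) = 0 := by
      rw [h, mul_zero, sub_zero] at hβ
      exact (mul_eq_zero.1 hβ).resolve_left (by linarith)
    have ht : x.1 1 = 0 := by
      rw [(hasDerivAt_upper _).deriv, div_eq_zero_iff] at hd
      rcases hd with hd | hd
      · linarith
      · exact absurd hd (by positivity)
    have hs1 : x.1 0 = 1 := by rw [hs, ht]; simp [upper]
    refine ⟨0, Or.inl rfl, ?_, Or.inr (Or.inr hs1)⟩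
    change label (x.1 0) (x.1 1) = branch 0 (x.1 0)
    rw [ht]
    simp [branch]

/-- Free ends come from multiples of `π`, merging points from peaks (reflected when `l < 0`), and
the top from `(1, 0)`. -/
theorem exists_toTree_eq_of_mem_treeVertices {p : tree} (hp : p ∈ treeVertices) :
    ∃ x : zeroSet (n + 1), (∀ i : Fin n, x.1 i.succ.succ = 0) ∧
      (x.1 0 - lower (x.1 1)) * deriv upper (x.1 1) -
          deriv lower (x.1 1) * (upper (x.1 1) - x.1 0) = 0 ∧ toTree x = p := by
  have key : ∀ s t, slice s t = 0 → p.1.1 = s → p.1.2 = label s t →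
      (s - lower t) * deriv upper t - deriv lower t * (upper t - s) = 0 →
      ∃ x : zeroSet (n + 1), (∀ i : Fin n, x.1 i.succ.succ = 0) ∧
      (x.1 0 - lower (x.1 1)) * deriv upper (x.1 1) -
          deriv lower (x.1 1) * (upper (x.1 1) - x.1 0) = 0 ∧ toTree x = p := by
    intro s t hs h1 h2 hβ
    exact ⟨⟨mkPoint s t 0, mkPoint_mem_zeroSet hs⟩, fun i => rfl, hβ,
      Subtype.ext (Prod.ext h1.symm h2.symm)⟩
  have klow : ∀ t, deriv lower t = 0 → p.1.1 = lower t → p.1.2 = label (lower t) t →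
      ∃ x : zeroSet (n + 1), (∀ i : Fin n, x.1 i.succ.succ = 0) ∧
      (x.1 0 - lower (x.1 1)) * deriv upper (x.1 1) -
          deriv lower (x.1 1) * (upper (x.1 1) - x.1 0) = 0 ∧ toTree x = p := by
    intro t hd h1 h2
    exact key _ t (by simp [slice]) h1 h2 (by simp [hd])
  obtain ⟨l, hl, hb, hs | hs | hs⟩ := hp
  · have h0 := lower_int_mul_pi l
    refine klow (l * Real.pi) ?_ (by rw [h0, hs]) (by rw [hb, h0, hs]; rfl)
    rw [(hasDerivAt_lower _).deriv, Real.sin_int_mul_pi]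
    simp
  · have hs' : p.1.1 = lower (peak l.natAbs) := hs
    rcases Int.natAbs_eq l with h | h
    · refine klow (peak l.natAbs) (deriv_lower_peak _) hs' ?_
      rw [label_peak, hb, ← h, hs']
    · refine klow (-peak l.natAbs) (by rw [deriv_lower_neg, deriv_lower_peak, neg_zero])
        (by rw [lower_neg]; exact hs') ?_
      rw [lower_neg, label_neg, label_peak, ← branch_neg, ← h, hb, hs']
  · have hl0 : l = 0 := by
      rcases hl with hl | hl
      · exact hl
      · rw [hs] at hl
        exact absurd (stemTop_le_one _) (not_le.2 hl)
    subst hl0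
    refine key 1 0 slice_one_zero hs (by rw [hb, hs]; simp [branch]) ?_
    rw [(hasDerivAt_lower _).deriv, (hasDerivAt_upper _).deriv]
    simp

theorem image_quotientMap_criticalPoints (hn : 0 < n) :
    letI := zeroSetChartedSpace n
    quotientMap (firstCoord (n + 1)) '' criticalPoints (m := n + 1) (firstCoord (n + 1)) =
      reebHomeomorph hn '' treeVertices := by
  let _ := zeroSetChartedSpace n
  ext p
  constructor
  · rintro ⟨x, hx, rfl⟩
    rw [mem_criticalPoints_iff] at hx
    exact ⟨toTree x, toTree_mem_treeVertices hx.1 hx.2, reebHomeomorph_toTree hn x⟩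
  · rintro ⟨v, hv, rfl⟩
    obtain ⟨x, h1, h2, rfl⟩ := exists_toTree_eq_of_mem_treeVertices (n := n) hv
    exact ⟨x, (mem_criticalPoints_iff x).2 ⟨h1, h2⟩, (reebHomeomorph_toTree hn x).symm⟩

end CriticalContours

/-! ### Dividing out simple zeros -/

section Division

theorem analyticOnNhd_dslope {h : ℝ → ℝ} (hh : AnalyticOnNhd ℝ h univ) (a : ℝ) :
    AnalyticOnNhd ℝ (dslope h a) univ := by
  intro t _
  by_cases hta : t = a
  · subst hta
    obtain ⟨p, hp⟩ := hh t (mem_univ t)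
    exact ⟨_, hp.has_fpower_series_dslope_fslope⟩
  · have h1 : AnalyticAt ℝ (fun x => (x - a)⁻¹ * (h x - h a)) t :=
      ((analyticAt_id.sub analyticAt_const).inv (sub_ne_zero.2 hta)).mul
        ((hh t (mem_univ t)).sub analyticAt_const)
    refine h1.congr ?_
    filter_upwards [isOpen_ne.mem_nhds hta] with x hx
    rw [dslope_of_ne _ hx, slope_def_field]
    field_simp

/-- An analytic function positive on an interval with simple zeros at the endpoints is the
product of `(t - a) * (b - t)` and a positive smooth function. -/
theorem exists_eq_mul_of_simple_zeros {h : ℝ → ℝ} (hh : AnalyticOnNhd ℝ h univ) {a b : ℝ}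
    (hab : a < b) (ha : h a = 0) (hb : h b = 0) (hda : deriv h a ≠ 0) (hdb : deriv h b ≠ 0)
    (hpos : ∀ t ∈ Ioo a b, 0 < h t) :
    ∃ k : ℝ → ℝ, ContDiff ℝ ∞ k ∧ (∀ t, h t = (t - a) * (b - t) * k t) ∧
      ∀ t ∈ Icc a b, 0 < k t := by
  have hg := analyticOnNhd_dslope hh a
  have h1 : ∀ t, (t - a) * dslope h a t = h t := fun t => by
    have := sub_smul_dslope h a t
    rwa [smul_eq_mul, ha, sub_zero] at this
  have hgb : dslope h a b = 0 := by
    have := h1 b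
    rw [hb] at this
    exact (mul_eq_zero.1 this).resolve_left (sub_pos.2 hab).ne'
  have h2 : ∀ t, (t - b) * dslope (dslope h a) b t = dslope h a t := fun t => by
    have := sub_smul_dslope (dslope h a) b t
    rwa [smul_eq_mul, hgb, sub_zero] at this
  let k : ℝ → ℝ := fun t => -dslope (dslope h a) b t
  have hk : ContDiff ℝ ∞ k := (analyticOnNhd_dslope hg b).contDiff.neg
  have hfac : ∀ t, h t = (t - a) * (b - t) * k t := fun t => by
    rw [← h1 t, ← h2 t]
    simp only [k]
    ring
  have hder : ∀ t, deriv h t = (b - t) * k t - (t - a) * k t + (t - a) * (b - t) * deriv k t := by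
    intro t
    have hkd : HasDerivAt k (deriv k t) t := (hk.differentiable (by simp) t).hasDerivAt
    have := ((((hasDerivAt_id t).sub_const a).mul ((hasDerivAt_id t).const_sub b)).mul hkd)
    rw [show h = fun t => (t - a) * (b - t) * k t from funext hfac]
    refine (this.congr_deriv ?_).deriv
    simp only [id, Pi.mul_apply]
    ring
  -- Positivity inside extends to `k ≥ 0` at the ends by continuity; a zero of `k` at an end would
  -- be a zero of `deriv h` there.
  have hnn : ∀ t ∈ Icc a b, 0 ≤ k t := by
    have hcl : IsClosed {t | 0 ≤ k t} := isClosed_le continuous_const hk.continuous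
    have hsub : Ioo a b ⊆ {t | 0 ≤ k t} := fun t ht => by
      have := hpos t ht
      rw [hfac t] at this
      exact (pos_of_mul_pos_right this
        (mul_pos (sub_pos.2 ht.1) (sub_pos.2 ht.2)).le).le
    have := closure_minimal hsub hcl
    rwa [closure_Ioo hab.ne] at this
  refine ⟨k, hk, hfac, fun t ht => (hnn t ht).lt_of_ne' fun h0 => ?_⟩
  rcases ht.1.eq_or_lt with hta | hta
  · subst hta
    apply hda
    rw [hder, h0]
    ring
  rcases ht.2.eq_or_lt with htb | htb
  · subst htb
    apply hdb
    rw [hder, h0]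
    ring
  have := hpos t ⟨hta, htb⟩
  rw [hfac, h0, mul_zero] at this
  exact this.false

end Division

/-! ### Regular contours are spheres -/

section RegularContours

variable {n : ℕ}

theorem hasDerivAt_slice (s t : ℝ) : HasDerivAt (slice s)
    ((s - lower t) * deriv upper t - deriv lower t * (upper t - s)) t := by
  have hl : HasDerivAt lower (deriv lower t) t := (hasDerivAt_lower t).differentiableAt.hasDerivAt
  have hu : HasDerivAt upper (deriv upper t) t := (hasDerivAt_upper t).differentiableAt.hasDerivAt
  refine ((hl.const_sub s).mul (hu.sub_const s)).congr_deriv ?_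
  ring

theorem analyticOnNhd_slice (s : ℝ) : AnalyticOnNhd ℝ (slice s) univ := by
  intro t _
  have hq : AnalyticAt ℝ (fun t : ℝ => t ^ 2 + 1) t := (analyticAt_id.pow 2).add analyticAt_const
  have hpos : t ^ 2 + 1 ≠ 0 := by positivity
  exact (analyticAt_const.sub ((Real.analyticAt_sin.pow 2).div (analyticAt_const.mul hq)
    (mul_ne_zero two_ne_zero hpos))).mul ((analyticAt_const.div hq hpos).sub analyticAt_const)

/-- A regular contour lies over an interval on which `slice` is positive with simple zeros at the
endpoints. -/
theorem exists_Icc_of_isRegularSet (hn : 0 < n) (x : zeroSet (n + 1))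
    (hreg : letI := zeroSetChartedSpace n
      IsRegularSet (m := n + 1) (firstCoord (n + 1)) (contour (firstCoord (n + 1)) x)) :
    ∃ a b, a < b ∧ slice (x.1 0) a = 0 ∧ slice (x.1 0) b = 0 ∧
      deriv (slice (x.1 0)) a ≠ 0 ∧ deriv (slice (x.1 0)) b ≠ 0 ∧
      (∀ t ∈ Ioo a b, 0 < slice (x.1 0) t) ∧
      ∀ y, y ∈ contour (firstCoord (n + 1)) x ↔ y.1 0 = x.1 0 ∧ y.1 1 ∈ Icc a b := by
  let _ := zeroSetChartedSpace n
  have hxr := mem_region_of_mem_zeroSet x.2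
  obtain ⟨a, b, hab, hI, ha, hb⟩ := exists_fiber_eq_Icc hxr
  set s := x.1 0 with hs
  have hcont : ∀ y, y ∈ contour (firstCoord (n + 1)) x ↔ y.1 0 = s ∧ y.1 1 ∈ Icc a b := by
    intro y
    rw [mem_contour_iff hn, toTree_eq_iff, hI]
    constructor
    · rintro ⟨h1, h2⟩
      rw [h1] at h2
      refine ⟨h1, ?_, h2⟩
      rw [hs, ← h1]
      exact mem_region_of_mem_zeroSet y.2
    · rintro ⟨h1, -, h2⟩
      rw [h1]
      exact ⟨rfl, h2⟩
  -- Over a zero of `slice s` the contour contains the point with `y = 0`, which would be critical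
  -- if the derivative vanished too.
  have hnd : ∀ t ∈ Icc a b, slice s t = 0 → deriv (slice s) t ≠ 0 := by
    intro t ht h0 hd
    refine hreg ⟨mkPoint s t 0, mkPoint_mem_zeroSet h0⟩ ((hcont _).2 ⟨rfl, ht⟩) ?_
    rw [mem_criticalPoints_iff]
    rw [(hasDerivAt_slice s t).deriv] at hd
    exact ⟨fun i => rfl, hd⟩
  have hnn : ∀ t ∈ Icc a b, 0 ≤ slice s t := fun t ht => slice_nonneg_iff.2 ((hI t).1 ht).1
  have hpos : ∀ t ∈ Ioo a b, 0 < slice s t := by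
    intro t ht
    refine (hnn t (Ioo_subset_Icc_self ht)).lt_of_ne' fun h0 => ?_
    refine hnd t (Ioo_subset_Icc_self ht) h0 (IsLocalMin.deriv_eq_zero ?_)
    filter_upwards [Icc_mem_nhds ht.1 ht.2] with u hu
    rw [h0]
    exact hnn u hu
  -- At a simple zero `slice s` is positive on one side, so a one-point fibre could be extended to
  -- that side.
  have hne : a ≠ b := by
    rintro rfl
    have haI := left_mem_Icc.2 hab
    have hfib : ∀ u, (∀ t ∈ uIcc a u, 0 ≤ slice s t) → u = a := fun u hu => by
      have hu' : ∀ t ∈ uIcc a u, lower t ≤ s := fun t ht => (slice_nonneg_iff.1 (hu t ht)).1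
      have h1 : label s u = label s a := by
        rcases le_total a u with h | h
        · rw [uIcc_of_le h] at hu'
          exact (label_eq_of_Icc_subset h hu').symm
        · rw [uIcc_of_ge h] at hu'
          exact label_eq_of_Icc_subset h hu'
      have h2 : u ∈ Icc a a :=
        (hI u).2 ⟨slice_nonneg_iff.1 (hu u right_mem_uIcc), h1.trans ((hI a).1 haI).2⟩
      rwa [Icc_self] at h2
    rcases (hnd a haI ha).lt_or_gt with hlt | hgt
    · have hev := eventually_nhdsWithin_sign_eq_of_deriv_neg hlt ha
      obtain ⟨ε, hε, hball⟩ := Metric.eventually_nhds_iff.1 hev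
      have := hfib (a - ε / 2) fun t ht => by
        rw [uIcc_of_ge (by linarith)] at ht
        have h1 := hball (y := t) (by rw [Real.dist_eq, abs_lt]; constructor <;> linarith [ht.1, ht.2])
        rw [← sign_nonneg_iff, h1, sign_nonneg_iff]
        exact sub_nonneg.2 ht.2
      linarith
    · have hev := eventually_nhdsWithin_sign_eq_of_deriv_pos hgt ha
      obtain ⟨ε, hε, hball⟩ := Metric.eventually_nhds_iff.1 hev
      have := hfib (a + ε / 2) fun t ht => by
        rw [uIcc_of_le (by linarith)] at ht
        have h1 := hball (y := t) (by rw [Real.dist_eq, abs_lt]; constructor <;> linarith [ht.1, ht.2])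
        rw [← sign_nonneg_iff, h1, sign_nonneg_iff]
        exact sub_nonneg.2 ht.1
      linarith
  exact ⟨a, b, hab.lt_of_ne hne, ha, hb, hnd a (left_mem_Icc.2 hab) ha,
    hnd b (right_mem_Icc.2 hab) hb, hpos, hcont⟩

/-- The parametrization of a contour by a sphere. -/
def sphereMap (s c d : ℝ) (k : ℝ → ℝ) (z : EuclideanSpace ℝ (Fin (n + 1))) :
    EuclideanSpace ℝ (Fin (n + 2)) :=
  mkPoint s (c + d * z 0) fun i => d * √(k (c + d * z 0)) * z i.succ

theorem norm_eq_one_iff_fin_succ (z : EuclideanSpace ℝ (Fin (n + 1))) :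
    ‖z‖ = 1 ↔ z 0 ^ 2 + ∑ i : Fin n, z i.succ ^ 2 = 1 := by
  rw [EuclideanSpace.norm_eq, Real.sqrt_eq_one, Fin.sum_univ_succ]
  simp only [Real.norm_eq_abs, sq_abs]

theorem abs_coord_zero_le_one {z : EuclideanSpace ℝ (Fin (n + 1))} (hz : ‖z‖ = 1) :
    z 0 ∈ Icc (-1 : ℝ) 1 := by
  rw [norm_eq_one_iff_fin_succ] at hz
  have : 0 ≤ ∑ i : Fin n, z i.succ ^ 2 := by positivity
  constructor <;> nlinarith

theorem contDiff_euclidean_coord {m : ℕ} (j : Fin m) :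
    ContDiff ℝ ∞ fun z : EuclideanSpace ℝ (Fin m) => z j :=
  (EuclideanSpace.proj j : EuclideanSpace ℝ (Fin m) →L[ℝ] ℝ).contDiff

theorem contDiffAt_sphereMap {s c d : ℝ} {k : ℝ → ℝ} (hk : ContDiff ℝ ∞ k)
    {z : EuclideanSpace ℝ (Fin (n + 1))} (hz : 0 < k (c + d * z 0)) :
    ContDiffAt ℝ ∞ (sphereMap s c d k) z := by
  have h0 := contDiff_euclidean_coord (0 : Fin (n + 1))
  rw [contDiffAt_euclidean]
  refine Fin.cases contDiffAt_const (Fin.cases ?_ fun i => ?_)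
  · exact (contDiff_const.add (contDiff_const.mul h0)).contDiffAt
  · have hsq : ContDiffAt ℝ ∞ (fun z : EuclideanSpace ℝ (Fin (n + 1)) => √(k (c + d * z 0))) z :=
      ContDiffAt.sqrt (hk.comp (contDiff_const.add (contDiff_const.mul h0))).contDiffAt hz.ne'
    exact (contDiffAt_const.mul hsq).mul (contDiff_euclidean_coord i.succ).contDiffAt

/-- Along a kernel vector `w` the second coordinate forces `w 0 = 0`. The factor `√k` is then
constant on the line through `z` in direction `w`, and the other coordinates force the rest of `w`
to vanish. -/
theorem fderiv_sphereMap_injective {s c d : ℝ} (hd : d ≠ 0) {k : ℝ → ℝ} (hk : ContDiff ℝ ∞ k)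
    {z : EuclideanSpace ℝ (Fin (n + 1))} (hz : 0 < k (c + d * z 0)) :
    Function.Injective (fderiv ℝ (sphereMap s c d k) z) := by
  rw [injective_iff_map_eq_zero]
  intro w hw
  have hF : HasFDerivAt (sphereMap s c d k) (fderiv ℝ (sphereMap s c d k) z) z :=
    ((contDiffAt_sphereMap hk hz).differentiableAt (by simp)).hasFDerivAt
  have hline : HasDerivAt (fun u : ℝ => z + u • w) w 0 := by
    simpa using ((hasDerivAt_id (0 : ℝ)).smul_const w).const_add z
  have hcomp : HasDerivAt (fun u : ℝ => sphereMap s c d k (z + u • w)) 0 0 := by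
    have hF' : HasFDerivAt (sphereMap s c d k) (fderiv ℝ (sphereMap s c d k) z)
        (z + (0 : ℝ) • w) := by rwa [zero_smul, add_zero]
    have := hF'.comp_hasDerivAt (0 : ℝ) hline
    rwa [hw] at this
  have hcoord : ∀ j, HasDerivAt (fun u : ℝ => sphereMap s c d k (z + u • w) j) 0 0 := fun j =>
    (EuclideanSpace.proj j : EuclideanSpace ℝ (Fin (n + 2)) →L[ℝ] ℝ).hasFDerivAt.comp_hasDerivAt
      (0 : ℝ) hcomp |>.congr_deriv (map_zero _)
  have hlin : ∀ p q : ℝ, HasDerivAt (fun u : ℝ => p + u * q) q 0 := fun p q => by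
    simpa using ((hasDerivAt_id (0 : ℝ)).mul_const q).const_add p
  have hw0 : w 0 = 0 := by
    have h1 : HasDerivAt (fun u : ℝ => c + d * (z 0 + u * w 0)) (d * w 0) 0 :=
      ((hlin (z 0) (w 0)).const_mul d).const_add c
    exact (mul_eq_zero.1 (h1.unique (hcoord 1))).resolve_left hd
  ext j
  refine Fin.cases hw0 (fun i => ?_) j
  have h1 : HasDerivAt (fun u : ℝ => d * √(k (c + d * z 0)) * (z i.succ + u * w i.succ))
      (d * √(k (c + d * z 0)) * w i.succ) 0 := (hlin _ _).const_mul _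
  have h2 : HasDerivAt (fun u : ℝ => d * √(k (c + d * z 0)) * (z i.succ + u * w i.succ)) 0 0 := by
    refine (hcoord i.succ.succ).congr_of_eventuallyEq (Filter.Eventually.of_forall fun u => ?_)
    change _ = d * √(k (c + d * (z 0 + u * w 0))) * (z i.succ + u * w i.succ)
    rw [hw0, mul_zero, add_zero]
  exact (mul_eq_zero.1 (h1.unique h2)).resolve_left (mul_ne_zero hd (Real.sqrt_pos.2 hz).ne')

theorem slice_eq_of_factor {s a b : ℝ} {k : ℝ → ℝ}
    (hfac : ∀ t, slice s t = (t - a) * (b - t) * k t) (r : ℝ) :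
    slice s ((a + b) / 2 + (b - a) / 2 * r) =
      ((b - a) / 2) ^ 2 * k ((a + b) / 2 + (b - a) / 2 * r) * (1 - r ^ 2) := by
  rw [hfac]
  ring

theorem affine_mem_Icc {a b r : ℝ} (hab : a < b) (hr : r ∈ Icc (-1 : ℝ) 1) :
    (a + b) / 2 + (b - a) / 2 * r ∈ Icc a b := by
  constructor <;> nlinarith [hr.1, hr.2]

theorem isDiffeomorphicToSphere_contour (hn : 0 < n) (x : zeroSet (n + 1))
    (hreg : letI := zeroSetChartedSpace n
      IsRegularSet (m := n + 1) (firstCoord (n + 1)) (contour (firstCoord (n + 1)) x)) :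
    letI := zeroSetChartedSpace n
    IsDiffeomorphicToSphere (m := n + 1) n (contour (firstCoord (n + 1)) x) := by
  let _ := zeroSetChartedSpace n
  have := isManifold_zeroSet n
  have : Fact (Module.finrank ℝ (EuclideanSpace ℝ (Fin (n + 1))) = n + 1) :=
    ⟨finrank_euclideanSpace_fin⟩
  obtain ⟨a, b, hab, ha, hb, hda, hdb, hpos, hcont⟩ := exists_Icc_of_isRegularSet hn x hreg
  set s := x.1 0
  obtain ⟨k, hk, hfac, hkpos⟩ := exists_eq_mul_of_simple_zeros (analyticOnNhd_slice s) hab ha hb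
    hda hdb hpos
  set c := (a + b) / 2 with hc
  set d := (b - a) / 2 with hd
  have hd0 : 0 < d := by rw [hd]; linarith
  have hslice := slice_eq_of_factor hfac
  rw [← hc, ← hd] at hslice
  have hIcc : ∀ r ∈ Icc (-1 : ℝ) 1, c + d * r ∈ Icc a b := fun r hr => affine_mem_Icc hab hr
  have hkz : ∀ z : Metric.sphere (0 : EuclideanSpace ℝ (Fin (n + 1))) 1,
      0 < k (c + d * z.1 0) := fun z =>
    hkpos _ (hIcc _ (abs_coord_zero_le_one (norm_eq_of_mem_sphere z)))
  have hmem : ∀ z : Metric.sphere (0 : EuclideanSpace ℝ (Fin (n + 1))) 1,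
      sphereMap s c d k z.1 ∈ zeroSet (n + 1) := by
    intro z
    have hz := (norm_eq_one_iff_fin_succ z.1).1 (norm_eq_of_mem_sphere z)
    rw [mem_zeroSet_iff]
    simp only [sphereMap, mkPoint_zero, mkPoint_one, mkPoint_succ_succ, mul_pow, hslice,
      Real.sq_sqrt (hkz z).le, ← Finset.mul_sum]
    rw [← sub_eq_iff_eq_add'.2 hz.symm]
  let f : Metric.sphere (0 : EuclideanSpace ℝ (Fin (n + 1))) 1 → zeroSet (n + 1) :=
    fun z => ⟨sphereMap s c d k z.1, hmem z⟩
  have hval : ContMDiff (𝓡 n) 𝓘(ℝ, EuclideanSpace ℝ (Fin (n + 2))) ∞ (Subtype.val ∘ f) := by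
    intro z
    exact (contDiffAt_sphereMap hk (hkz z)).contMDiffAt.comp z (contMDiff_coe_sphere z)
  have hfc : Continuous f := Continuous.subtype_mk hval.continuous _
  have himm : ∀ y : zeroSet (n + 1), IsImmersionAtOfComplement ℝ (𝓡 (n + 1))
      𝓘(ℝ, EuclideanSpace ℝ (Fin (n + 2))) ∞ (Subtype.val : zeroSet (n + 1) → _) y :=
    (isRegularZero_definingFun n).isImmersionAtOfComplement_val
  -- Smoothness into the hypersurface is tested after the inclusion, which is an immersion.
  have hf : ContMDiff (𝓡 n) (𝓡 (n + 1)) ∞ f := fun z =>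
    (ContMDiffAt.iff_comp_isImmersionAtOfComplement (himm (f z))).2
      ⟨hfc.continuousAt, hval z⟩
  have hinj : Function.Injective f := by
    intro z z' h
    have h' : sphereMap s c d k z.1 = sphereMap s c d k z'.1 := congrArg Subtype.val h
    have h1 : c + d * z.1 0 = c + d * z'.1 0 :=
      congrArg (fun y : EuclideanSpace ℝ (Fin (n + 2)) => y 1) h'
    have h0 : z.1 0 = z'.1 0 := mul_left_cancel₀ hd0.ne' (add_left_cancel h1)
    apply Subtype.ext
    ext j
    refine Fin.cases h0 (fun i => ?_) j
    have h2 : d * √(k (c + d * z.1 0)) * z.1 i.succ = d * √(k (c + d * z'.1 0)) * z'.1 i.succ :=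
      congrArg (fun y : EuclideanSpace ℝ (Fin (n + 2)) => y i.succ.succ) h'
    rw [← h0] at h2
    exact mul_left_cancel₀ (mul_pos hd0 (Real.sqrt_pos.2 (hkz z))).ne' h2
  have hdf : ∀ z, Function.Injective (mfderiv (𝓡 n) (𝓡 (n + 1)) f z) := by
    intro z
    have hcoe := injective_mvfderiv_subtypeVal_sphere (n := n) z
    have hD1 : MDifferentiableAt 𝓘(ℝ, EuclideanSpace ℝ (Fin (n + 1)))
        𝓘(ℝ, EuclideanSpace ℝ (Fin (n + 2))) (sphereMap s c d k) z.1 :=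
      ((contDiffAt_sphereMap hk (hkz z)).contMDiffAt).mdifferentiableAt (by simp)
    have hD2 : MDifferentiableAt (𝓡 n) 𝓘(ℝ, EuclideanSpace ℝ (Fin (n + 1)))
        (Subtype.val : Metric.sphere (0 : EuclideanSpace ℝ (Fin (n + 1))) 1 → _) z :=
      (contMDiff_coe_sphere (m := ∞) z).mdifferentiableAt (by simp)
    have h1 := mfderiv_comp z hD1 hD2
    have h2 := mfderiv_comp (I' := 𝓡 (n + 1)) z
      (((isSmoothEmbedding_zeroSet_val n).contMDiff (f z)).mdifferentiableAt (by simp))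
      ((hf z).mdifferentiableAt (by simp))
    have h3 : Function.Injective (mfderiv (𝓡 n) 𝓘(ℝ, EuclideanSpace ℝ (Fin (n + 2)))
        (sphereMap s c d k ∘ Subtype.val) z) := by
      rw [h1, mfderiv_eq_fderiv]
      exact (fderiv_sphereMap_injective hd0.ne' hk (hkz z)).comp hcoe
    have h4 : Function.Injective (mfderiv (𝓡 n) 𝓘(ℝ, EuclideanSpace ℝ (Fin (n + 2)))
        ((Subtype.val : zeroSet (n + 1) → _) ∘ f) z) := h3
    rw [h2] at h4
    exact Function.Injective.of_comp h4
  refine ⟨f, ⟨?_, (hfc.isClosedEmbedding hinj).isEmbedding⟩, ?_⟩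
  · refine IsImmersionOfComplement.isImmersion (F := ℝ) fun z => ?_
    exact isImmersionAtOfComplement_of_injective_mfderiv ℝ (by simp) hf (hdf z)
  · ext y
    rw [hcont]
    constructor
    · rintro ⟨z, rfl⟩
      exact ⟨rfl, hIcc _ (abs_coord_zero_le_one (norm_eq_of_mem_sphere z))⟩
    · rintro ⟨h0, h1⟩
      obtain ⟨r, hr⟩ : ∃ r, c + d * r = y.1 1 := ⟨(y.1 1 - c) / d, by field_simp; ring⟩
      have hkr : 0 < k (c + d * r) := by rw [hr]; exact hkpos _ h1
      have hsq := Real.sqrt_pos.2 hkr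
      -- The inverse parametrization: normalize `x₂` affinely to `[-1, 1]` and divide `y` by `d *
      -- √k`.
      let z : EuclideanSpace ℝ (Fin (n + 1)) :=
        WithLp.toLp 2 (Fin.cons r fun i => y.1 i.succ.succ / (d * √(k (c + d * r))))
      have hz : ‖z‖ = 1 := by
        rw [norm_eq_one_iff_fin_succ]
        change r ^ 2 + ∑ i : Fin n, (y.1 i.succ.succ / (d * √(k (c + d * r)))) ^ 2 = 1
        have hsum := (mem_zeroSet_iff y.1).1 y.2
        rw [h0, ← hr, hslice] at hsum
        simp only [div_pow, ← Finset.sum_div, hsum, mul_pow, Real.sq_sqrt hkr.le]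
        rw [mul_div_cancel_left₀ _ (mul_pos (pow_pos hd0 2) hkr).ne']
        ring
      refine ⟨⟨z, by simpa using hz⟩, Subtype.ext (euclideanSpace_ext h0.symm hr fun i => ?_)⟩
      change d * √(k (c + d * r)) * (y.1 i.succ.succ / (d * √(k (c + d * r)))) = _
      field_simp

end RegularContours

/-- The tree is the continuous image of a connected hypersurface; `n = 1` is an arbitrary positive
choice. -/
theorem connectedSpace_tree : ConnectedSpace tree := by
  have := isConnected_iff_connectedSpace.1 (isConnected_zeroSet one_pos)
  exact (surjective_toTree one_pos).connectedSpace (continuous_toTree (n := 1))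

end Reeb

end

/-! ### Assembly of the theorem -/

theorem theorem1 :
    ∃ (G : Type) (_ : TopologicalSpace G) (_ : CWComplex (univ : Set G)),
      ConnectedSpace G ∧ Reeb.IsInfiniteGraph G ∧
      ∀ m : ℕ, 1 < m →
        AnalyticOnNhd ℝ (Reeb.definingFun m) univ ∧
        IsConnected (Reeb.zeroSet m) ∧
        ¬ IsCompact (Reeb.zeroSet m) ∧
        ∃ _ : ChartedSpace (EuclideanSpace ℝ (Fin m)) (Reeb.zeroSet m),
          IsManifold (𝓡 m) ∞ (Reeb.zeroSet m) ∧
          IsSmoothEmbedding (𝓡 m) 𝓘(ℝ, EuclideanSpace ℝ (Fin (m + 1))) ∞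
            (Subtype.val : Reeb.zeroSet m → EuclideanSpace ℝ (Fin (m + 1))) ∧
          ContMDiff (𝓡 m) 𝓘(ℝ, ℝ) ∞ (Reeb.firstCoord m) ∧
          (∃ _ : CWComplex (univ : Set (Reeb.ReebSpace (Reeb.firstCoord m))),
            Reeb.IsReebGraph (m := m) (Reeb.firstCoord m) ∧
            Reeb.GraphIsomorphic G (Reeb.ReebSpace (Reeb.firstCoord m))) ∧
          (∀ K : Set (Reeb.ReebSpace (Reeb.firstCoord m)), IsCompact K →
            IsCompact (Reeb.quotientMap (Reeb.firstCoord m) ⁻¹' K)) ∧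
          (∀ x : Reeb.zeroSet m,
            Reeb.IsRegularSet (m := m) (Reeb.firstCoord m)
              (Reeb.contour (Reeb.firstCoord m) x) →
            Reeb.IsDiffeomorphicToSphere (m := m) (m - 1)
              (Reeb.contour (Reeb.firstCoord m) x)) := by
  refine ⟨Reeb.tree, inferInstance, Reeb.treeGraph.cwComplex, Reeb.connectedSpace_tree,
    Reeb.treeGraph.isInfiniteGraph, fun m hm => ?_⟩
  obtain ⟨n, rfl⟩ : ∃ n, m = n + 1 := ⟨m - 1, by omega⟩
  have hn : 0 < n := by omega
  let _ := Reeb.zeroSetChartedSpace n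
  have := (Reeb.reebHomeomorph hn).t2Space
  -- The graph structure on the Reeb space is transported from `tree`, so the isomorphism with the
  -- common graph is built in.
  let D := Reeb.treeGraph.map (Reeb.reebHomeomorph hn)
  have : Nonempty D.ι := inferInstanceAs (Nonempty Reeb.treeGraph.ι)
  let _ := D.cwComplex
  exact ⟨Reeb.analyticOnNhd_definingFun (n + 1), Reeb.isConnected_zeroSet hn,
    Reeb.not_isCompact_zeroSet, Reeb.zeroSetChartedSpace n, Reeb.isManifold_zeroSet n,
    Reeb.isSmoothEmbedding_zeroSet_val n, Reeb.contMDiff_firstCoord n,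
    ⟨D.cwComplex,
      ⟨D.isGraph, D.vertexSet_eq.trans (Reeb.image_quotientMap_criticalPoints hn).symm⟩,
      Reeb.treeGraph.graphIsomorphic_map (Reeb.reebHomeomorph hn)⟩,
    fun K hK => Reeb.isCompact_preimage_quotientMap hn hK,
    fun x hx => Reeb.isDiffeomorphicToSphere_contour hn x hx⟩
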